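/- **Theorem (law of large numbers).** For integers $n,m,k,l\ge 0$ with $m,k\le n$ and $m+k-n\le l\le \min(m,k)$, put $M:=m-l$, $N:=n-m-k+l$ and $$|\Xi_{n,m|k,l}\rangle := |1\rangle^{\otimes l}\otimes|0\rangle^{\otimes (k-l)}\otimes \binom{N+M}{M}^{-1/2}\sum_{w}|w\rangle \in (\mathbb C^2)^{\otimes n},$$ where $w$ runs over the words in $\{0,1\}^{N+M}$ with exactly $M$ letters $1$. For $0\le x\le\lfloor n/2\rfloor$ let $\mathsf P_{(n-x,x)}$ be the orthogonal projector of $(\mathbb C^2)^{\otimes n}$ onto the isotypical component $\mathcal U_{(n-x,x)}\boxtimes\mathcal V_{(n-x,x)}$ in the Schur–Weyl decomposition, i.e. onto the sum of all irreducible $\mathrm{SU}(2)$-subrepresentations of dimension $n-2x+1$. Let $P_{n,m,k,l}$ be the distribution on $\{0,1,\dots,\lfloor n/2\rfloor\}$ with probability mass function $p(x)=\langle\Xi_{n,m|k,l}|\mathsf P_{(n-x,x)}|\Xi_{n,m|k,l}\rangle$ (this is a probability distribution), and let $X$ be a random variable with this distribution. Consider the limit $n\to\infty$ with fixed ratios $$\alpha=\tfrac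 ln,\qquad \beta=\tfrac{m-l}{n},\qquad \gamma=\tfrac{k-l}{n},\qquad \delta=\tfrac{n-m-k+l}{n},$$ i.e. along any sequence of parameters $(n,m,k,l)$ as above with these ratios and $n\to\infty$. Put $D:=1-4(\alpha\gamma+\alpha\delta+\beta\gamma)$ and $\mu:=\frac{1-\sqrt D}{2}$. Then for every $\varepsilon>0$ $$\lim_{n\to\infty}P_{n,m,k,l}\Bigl[\bigl|\tfrac Xn-\mu\bigr|>\varepsilon\Bigr]=0,$$ and the expectation satisfies $\mathbb E[X]=n\mu+o(n)$. -/

import Mathlib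

open MeasureTheory Filter Topology

noncomputable section

namespace XiDist

/-- The `n`-qubit space `(ℂ²)^{⊗n}` in coordinates: a vector is the family of its coefficients
in the orthonormal standard basis `|i₁ … iₙ⟩`, where each `i_r` is `0` or `1`. -/
abbrev QubitSpace (n : ℕ) : Type := EuclideanSpace ℂ (Fin n → Fin 2)

/-- The matrix of `U ⊗ ⋯ ⊗ U` (`n` factors) in the standard basis. -/
def tensorPowMatrix (n : ℕ) (U : Matrix (Fin 2) (Fin 2) ℂ) :
    Matrix (Fin n → Fin 2) (Fin n → Fin 2) ℂ :=
  Matrix.of fun i j => ∏ r, U (i r) (j r)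

theorem tensorPowMatrix_one (n : ℕ) : tensorPowMatrix n 1 = 1 := by
  ext i j
  simp only [tensorPowMatrix, Matrix.of_apply, Matrix.one_apply, Finset.prod_ite_zero,
    Finset.prod_const_one, Finset.mem_univ, true_implies, funext_iff]

theorem tensorPowMatrix_mul (n : ℕ) (U V : Matrix (Fin 2) (Fin 2) ℂ) :
    tensorPowMatrix n (U * V) = tensorPowMatrix n U * tensorPowMatrix n V := by
  ext i j
  simp only [tensorPowMatrix, Matrix.of_apply, Matrix.mul_apply, ← Finset.prod_mul_distrib]
  rw [Finset.prod_univ_sum, Fintype.piFinset_univ]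

/-- The representation of `SU(2)` on `(ℂ²)^{⊗n}` by `U ↦ U ⊗ ⋯ ⊗ U`. -/
def tensorRep (n : ℕ) :
    Representation ℂ (Matrix.specialUnitaryGroup (Fin 2) ℂ) (QubitSpace n) where
  toFun U := Matrix.toLpLin 2 2 (tensorPowMatrix n (U : Matrix (Fin 2) (Fin 2) ℂ))
  map_one' := by
    rw [OneMemClass.coe_one, tensorPowMatrix_one, Matrix.toLpLin_one]
    rfl
  map_mul' U V := by
    rw [Submonoid.coe_mul, tensorPowMatrix_mul, Matrix.toLpLin_mul_same]
    rfl

/-- For `0 ≤ x ≤ ⌊n/2⌋`, the isotypical component `𝒰_{(n-x,x)} ⊠ 𝒱_{(n-x,x)}` of the Schur-Weyl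
decomposition of `(ℂ²)^{⊗n}`: the sum of all irreducible `SU(2)`-subrepresentations of dimension
`n - 2x + 1`, i.e. of all those equivalent to the highest weight irrep `𝒰_{(n-x,x)}`
(up to equivalence, `SU(2)` has exactly one continuous irrep of each dimension). -/
def isotypicalComponent (n x : ℕ) : Submodule ℂ (QubitSpace n) :=
  ⨆ (σ : Subrepresentation (tensorRep n)) (_ : σ.toRepresentation.IsIrreducible)
    (_ : Module.finrank ℂ σ.toSubmodule = n - 2 * x + 1), σ.toSubmodule

/-- The range of the parameters `(n, m, k, l)`:
`m, k ≤ n` and `m + k - n ≤ l ≤ min m k`. -/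
def Admissible (n m k l : ℕ) : Prop :=
  m ≤ n ∧ k ≤ n ∧ m + k ≤ n + l ∧ l ≤ m ∧ l ≤ k

/-- The vector `|1^l 0^{k-l}⟩ ⊗ |Ξ_{N+M,M}⟩`, where `M = m - l`, `N = n - m - k + l` and
`|Ξ_{N+M,M}⟩` is the Dicke state: the sum, divided by the square root of `(N+M).choose M`, of all
basis vectors of `(ℂ²)^{⊗(N+M)}` with exactly `M` entries equal to `1`.
Note that `N + M = n - k`. -/
def xiVector (n m k l : ℕ) : QubitSpace n :=
  WithLp.toLp 2 fun i =>
    (if ∀ r : Fin n, (r : ℕ) < k → i r = (if (r : ℕ) < l then 1 else 0) then (1 : ℂ) else 0) *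
      (if (Finset.univ.filter fun r : Fin n => k ≤ (r : ℕ) ∧ i r = 1).card = m - l then
        (((Real.sqrt ((n - k).choose (m - l) : ℝ))⁻¹ : ℝ) : ℂ) else 0)

/-- `p(x | n,m,k,l) = ⟨Ξ| P_{(n-x,x)} |Ξ⟩`, with `P_{(n-x,x)}` the orthogonal projector onto the
isotypical component. -/
def pmf (n m k l x : ℕ) : ℝ :=
  (inner ℂ (xiVector n m k l)
    ((isotypicalComponent n x).starProjection (xiVector n m k l))).re

/-- The distribution `P_{n,m,k,l}` on `{0, …, ⌊n/2⌋}` with mass `p(x | n,m,k,l)` at `x`,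
as a measure on `ℕ`. -/
def law (n m k l : ℕ) : Measure ℕ :=
  ∑ x ∈ Finset.range (n / 2 + 1), ENNReal.ofReal (pmf n m k l x) • Measure.dirac x

/-- `D = 1 - 4(αγ + αδ + βγ)`. -/
def discr (α β γ δ : ℝ) : ℝ := 1 - 4 * (α * γ + α * δ + β * γ)

/-- `μ = (1 - √D) / 2`. -/
def limitMean (α β γ δ : ℝ) : ℝ := (1 - Real.sqrt (discr α β γ δ)) / 2

end XiDist

end

/-! The Casimir operator `C = 4FE + H² + 2H` of the total spin is self-adjoint and acts on the
isotypical component of index `x` as the scalar `(n-2x)(n-2x+2)`. These scalars are distinct, so the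
components are orthogonal, and they span the whole space. Hence the second moment of `casimirValue n
X` about a real number `c` is `‖(C - c)Ξ‖²` (`sum_sq_mul_inner_starProjection`).

The point is that `Ξ` is almost an eigenvector of `C`. It is an exact eigenvector of `H`. Split `E`
and `F` into a head part (the first `k` sites) and a tail part. On the Dicke factor the tail part of
`FE` is the exact scalar `M(N+1)`. Every other term contains a head operator, which can be applied
to `Ξ` first; since the head is a fixed word, this gives a sum of at most `n` orthogonal vectors of
norm at most 1, hence norm at most `√n`. The remaining factor costs at most `n`, so `‖(C - c)Ξ‖ ≤ 12
n^{3/2}` (`norm_casimir_xiVector_sub_le`), which is small against the scale `n²` of `C`.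

Dividing by `n²`, `(1 - 2X/n)²` is close to `D` in mean square. As `1 - 2X/n` and `√D` are
nonnegative, this gives a fourth moment of `X/n - μ` of at most `20/n` (`sum_pow_four_mul_pmf_le`).
Both the law of large numbers and the expectation follow.

The representation theory behind the first paragraph rests on one translation: subrepresentations of
`SU(2)` are exactly the subspaces stable under `E` and `F`. After that, highest weight vectors
determine the irreducibles. -/

noncomputable section

namespace XiDist

open scoped InnerProductSpace

variable {n : ℕ}

/-! ### Product operators, one-site operators and their sums. -/

/-- The operator `A₁ ⊗ ⋯ ⊗ Aₙ` on `(ℂ²)^{⊗n}`. -/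
def tensorOp (A : Fin n → Matrix (Fin 2) (Fin 2) ℂ) : Module.End ℂ (QubitSpace n) :=
  Matrix.toLpLin 2 2 (Matrix.of fun i j => ∏ r, A r (i r) (j r))

theorem tensorOp_apply (A : Fin n → Matrix (Fin 2) (Fin 2) ℂ) (v : QubitSpace n)
    (i : Fin n → Fin 2) : tensorOp A v i = ∑ j, (∏ r, A r (i r) (j r)) * v j := by
  simp [tensorOp, Matrix.toLpLin_apply, Matrix.mulVec, dotProduct]

theorem tensorOp_one : tensorOp (1 : Fin n → Matrix (Fin 2) (Fin 2) ℂ) = 1 := by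
  have h := tensorPowMatrix_one n
  simp only [tensorPowMatrix] at h
  simp only [tensorOp, Pi.one_apply]
  rw [h, Matrix.toLpLin_one]
  rfl

theorem tensorOp_mul (A B : Fin n → Matrix (Fin 2) (Fin 2) ℂ) :
    tensorOp (A * B) = tensorOp A * tensorOp B := by
  rw [tensorOp, tensorOp, tensorOp, Module.End.mul_eq_comp, ← Matrix.toLpLin_mul_same]
  congr 1
  ext i j
  simp only [Matrix.of_apply, Matrix.mul_apply, ← Finset.prod_mul_distrib, Pi.mul_apply]
  rw [Finset.prod_univ_sum, Fintype.piFinset_univ]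

theorem inner_tensorOp (A : Fin n → Matrix (Fin 2) (Fin 2) ℂ) (v w : QubitSpace n) :
    ⟪tensorOp A v, w⟫_ℂ = ⟪v, tensorOp (fun r => (A r).conjTranspose) w⟫_ℂ := by
  simp only [PiLp.inner_apply, tensorOp_apply, RCLike.inner_apply, map_sum, Finset.mul_sum,
    Finset.sum_mul, map_mul, map_prod, Matrix.conjTranspose_apply]
  rw [Finset.sum_comm]
  refine Finset.sum_congr rfl fun j _ => Finset.sum_congr rfl fun i _ => ?_
  simp only [starRingEnd_apply]
  ring

/-- The operator `A` acting on the `r`-th tensor factor. -/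
def siteOp (r : Fin n) (A : Matrix (Fin 2) (Fin 2) ℂ) : Module.End ℂ (QubitSpace n) :=
  tensorOp (Function.update 1 r A)

theorem prod_update_one (r : Fin n) (A : Matrix (Fin 2) (Fin 2) ℂ) (i j : Fin n → Fin 2) :
    ∏ s, Function.update (1 : Fin n → Matrix (Fin 2) (Fin 2) ℂ) r A s (i s) (j s) =
      A (i r) (j r) * ∏ s ∈ Finset.univ.erase r, (1 : Matrix (Fin 2) (Fin 2) ℂ) (i s) (j s) := by
  rw [← Finset.mul_prod_erase _ _ (Finset.mem_univ r), Function.update_self]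
  congr 1
  refine Finset.prod_congr rfl fun s hs => ?_
  rw [Function.update_of_ne (Finset.ne_of_mem_erase hs), Pi.one_apply]

theorem siteOp_apply (r : Fin n) (A : Matrix (Fin 2) (Fin 2) ℂ) (v : QubitSpace n)
    (i : Fin n → Fin 2) : siteOp r A v i = ∑ a, A (i r) a * v (Function.update i r a) := by
  rw [siteOp, tensorOp_apply]
  simp only [prod_update_one]
  rw [← Finset.sum_subset (Finset.subset_univ (Finset.univ.image (Function.update i r)))]
  · rw [Finset.sum_image (fun a _ b _ h => Function.update_injective i r h)]
    refine Finset.sum_congr rfl fun a _ => ?_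
    rw [Function.update_self, Finset.prod_eq_one, mul_one]
    intro s hs
    rw [Function.update_of_ne (Finset.ne_of_mem_erase hs), Matrix.one_apply_eq]
  · intro j _ hj
    have : ∃ s ∈ Finset.univ.erase r, i s ≠ j s := by
      by_contra! h
      refine hj (Finset.mem_image.2 ⟨j r, Finset.mem_univ _, ?_⟩)
      ext s
      by_cases hs : s = r
      · subst hs; simp
      · rw [Function.update_of_ne hs, h s (by simp [hs])]
    obtain ⟨s, hs, hne⟩ := this
    have h0 : ∏ s ∈ Finset.univ.erase r, (1 : Matrix (Fin 2) (Fin 2) ℂ) (i s) (j s) = 0 :=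
      Finset.prod_eq_zero hs (Matrix.one_apply_ne hne)
    rw [h0, mul_zero, zero_mul]

theorem siteOp_mul (r : Fin n) (A B : Matrix (Fin 2) (Fin 2) ℂ) :
    siteOp r A * siteOp r B = siteOp r (A * B) := by
  rw [siteOp, siteOp, siteOp, ← tensorOp_mul, ← Function.update_mul, one_mul]

theorem siteOp_commute {r s : Fin n} (h : r ≠ s) (A B : Matrix (Fin 2) (Fin 2) ℂ) :
    Commute (siteOp r A) (siteOp s B) := by
  rw [Commute, SemiconjBy, siteOp, siteOp, ← tensorOp_mul, ← tensorOp_mul]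
  congr 1
  ext1 t
  by_cases hr : t = r
  · subst hr; simp [Function.update_of_ne h]
  · simp [Function.update_of_ne hr]

theorem siteOp_one (r : Fin n) : siteOp r 1 = 1 := by
  rw [siteOp, ← tensorOp_one]
  congr 1
  exact Function.update_eq_self r 1

theorem siteOp_add (r : Fin n) (A B : Matrix (Fin 2) (Fin 2) ℂ) :
    siteOp r (A + B) = siteOp r A + siteOp r B := by
  ext v i
  simp [siteOp_apply, add_mul, Finset.sum_add_distrib]

theorem siteOp_smul (r : Fin n) (c : ℂ) (A : Matrix (Fin 2) (Fin 2) ℂ) :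
    siteOp r (c • A) = c • siteOp r A := by
  ext v i
  simp [siteOp_apply, mul_assoc, mul_add]

theorem inner_siteOp (r : Fin n) (A : Matrix (Fin 2) (Fin 2) ℂ) (v w : QubitSpace n) :
    ⟪siteOp r A v, w⟫_ℂ = ⟪v, siteOp r A.conjTranspose w⟫_ℂ := by
  rw [siteOp, inner_tensorOp, siteOp]
  congr 3
  ext1 s
  by_cases hs : s = r
  · subst hs; simp
  · simp [Function.update_of_ne hs]

/-- The operator `∑_{r ∈ s} A_r`, with `A_r` acting on the `r`-th tensor factor. -/
def sumOp (s : Finset (Fin n)) (A : Matrix (Fin 2) (Fin 2) ℂ) : Module.End ℂ (QubitSpace n) :=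
  ∑ r ∈ s, siteOp r A

theorem sumOp_add (s : Finset (Fin n)) (A B : Matrix (Fin 2) (Fin 2) ℂ) :
    sumOp s (A + B) = sumOp s A + sumOp s B := by
  simp [sumOp, siteOp_add, Finset.sum_add_distrib]

theorem sumOp_smul (s : Finset (Fin n)) (c : ℂ) (A : Matrix (Fin 2) (Fin 2) ℂ) :
    sumOp s (c • A) = c • sumOp s A := by
  simp [sumOp, siteOp_smul, Finset.smul_sum]

theorem sumOp_neg (s : Finset (Fin n)) (A : Matrix (Fin 2) (Fin 2) ℂ) :
    sumOp s (-A) = -sumOp s A := by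
  rw [← neg_one_smul ℂ A, sumOp_smul, neg_one_smul]

theorem sumOp_sub (s : Finset (Fin n)) (A B : Matrix (Fin 2) (Fin 2) ℂ) :
    sumOp s (A - B) = sumOp s A - sumOp s B := by
  rw [sub_eq_add_neg, sumOp_add, sumOp_neg, ← sub_eq_add_neg]

theorem inner_sumOp (s : Finset (Fin n)) (A : Matrix (Fin 2) (Fin 2) ℂ) (v w : QubitSpace n) :
    ⟪sumOp s A v, w⟫_ℂ = ⟪v, sumOp s A.conjTranspose w⟫_ℂ := by
  simp only [sumOp, LinearMap.sum_apply, sum_inner, inner_sum, inner_siteOp]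

/-- Operators at different sites commute, so only the terms with both factors at the same site
survive. -/
theorem sumOp_commutator (s : Finset (Fin n)) (A B : Matrix (Fin 2) (Fin 2) ℂ) :
    sumOp s A * sumOp s B - sumOp s B * sumOp s A = sumOp s (A * B - B * A) := by
  have h : ∀ r ∈ s, siteOp r A * sumOp s B - sumOp s B * siteOp r A
      = siteOp r (A * B - B * A) := by
    intro r hr
    rw [sumOp, Finset.mul_sum, Finset.sum_mul, ← Finset.sum_sub_distrib,
      Finset.sum_eq_single_of_mem r hr]
    · rw [siteOp_mul, siteOp_mul, sub_eq_add_neg (A * B), siteOp_add, ← neg_one_smul ℂ (B * A),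
        siteOp_smul, neg_one_smul, sub_eq_add_neg]
    · intro t _ ht
      rw [(siteOp_commute ht.symm A B).eq, sub_self]
  calc _ = ∑ r ∈ s, (siteOp r A * sumOp s B - sumOp s B * siteOp r A) := by
        rw [Finset.sum_sub_distrib, ← Finset.sum_mul, ← Finset.mul_sum, ← sumOp]
    _ = _ := Finset.sum_congr rfl h

theorem sumOp_commute {s t : Finset (Fin n)} (h : Disjoint s t)
    (A B : Matrix (Fin 2) (Fin 2) ℂ) : Commute (sumOp s A) (sumOp t B) :=
  Commute.sum_left _ _ _ fun _ hr => Commute.sum_right _ _ _ fun _ hr' =>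
    siteOp_commute (Finset.disjoint_iff_ne.1 h _ hr _ hr') A B

/-! ### The action of sl(2) and the Casimir operator. -/

/-- The matrix `|0⟩⟨1|`. -/
def eMat : Matrix (Fin 2) (Fin 2) ℂ := !![0, 1; 0, 0]

/-- The matrix `|1⟩⟨0|`. -/
def fMat : Matrix (Fin 2) (Fin 2) ℂ := !![0, 0; 1, 0]

/-- The matrix `|0⟩⟨0| - |1⟩⟨1|`. -/
def hMat : Matrix (Fin 2) (Fin 2) ℂ := !![1, 0; 0, -1]

theorem eMat_mul_eMat : eMat * eMat = 0 := by ext i j; fin_cases i <;> fin_cases j <;> simp [eMat]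

theorem fMat_mul_fMat : fMat * fMat = 0 := by ext i j; fin_cases i <;> fin_cases j <;> simp [fMat]

theorem eMat_conjTranspose : eMat.conjTranspose = fMat := by
  ext i j; fin_cases i <;> fin_cases j <;> simp [eMat, fMat]

theorem fMat_conjTranspose : fMat.conjTranspose = eMat := by
  ext i j; fin_cases i <;> fin_cases j <;> simp [eMat, fMat]

theorem hMat_conjTranspose : hMat.conjTranspose = hMat := by
  ext i j; fin_cases i <;> fin_cases j <;> simp [hMat]

theorem eMat_fMat_commutator : eMat * fMat - fMat * eMat = hMat := by
  ext i j; fin_cases i <;> fin_cases j <;> simp [eMat, fMat, hMat]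

theorem hMat_eMat_commutator : hMat * eMat - eMat * hMat = (2 : ℂ) • eMat := by
  ext i j; fin_cases i <;> fin_cases j <;> simp [eMat, hMat]; norm_num

theorem hMat_fMat_commutator : hMat * fMat - fMat * hMat = -((2 : ℂ) • fMat) := by
  ext i j; fin_cases i <;> fin_cases j <;> simp [fMat, hMat]; norm_num

theorem fMat_eMat_add : fMat * eMat + eMat * fMat = 1 := by
  ext i j; fin_cases i <;> fin_cases j <;> simp [eMat, fMat]

/-- The raising operator, the total `|0⟩⟨1|`. -/
def opE (n : ℕ) : Module.End ℂ (QubitSpace n) := sumOp Finset.univ eMat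

/-- The lowering operator, the total `|1⟩⟨0|`. -/
def opF (n : ℕ) : Module.End ℂ (QubitSpace n) := sumOp Finset.univ fMat

/-- The weight operator: the number of letters `0` minus the number of letters `1`. -/
def opH (n : ℕ) : Module.End ℂ (QubitSpace n) := sumOp Finset.univ hMat

theorem opE_opF_commutator : opE n * opF n - opF n * opE n = opH n := by
  rw [opE, opF, opH, sumOp_commutator, eMat_fMat_commutator]

theorem opH_opE_commutator : opH n * opE n - opE n * opH n = (2 : ℂ) • opE n := by
  rw [opE, opH, sumOp_commutator, hMat_eMat_commutator, sumOp_smul]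

theorem opH_opF_commutator : opH n * opF n - opF n * opH n = -((2 : ℂ) • opF n) := by
  rw [opF, opH, sumOp_commutator, hMat_fMat_commutator, sumOp_neg, sumOp_smul]

theorem inner_opE (v w : QubitSpace n) : ⟪opE n v, w⟫_ℂ = ⟪v, opF n w⟫_ℂ := by
  rw [opE, inner_sumOp, eMat_conjTranspose, opF]

theorem inner_opF (v w : QubitSpace n) : ⟪opF n v, w⟫_ℂ = ⟪v, opE n w⟫_ℂ := by
  rw [opF, inner_sumOp, fMat_conjTranspose, opE]

theorem inner_opH (v w : QubitSpace n) : ⟪opH n v, w⟫_ℂ = ⟪v, opH n w⟫_ℂ := by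
  rw [opH, inner_sumOp, hMat_conjTranspose]

/-- The number of letters `1` of a word. -/
def ones (i : Fin n → Fin 2) : ℕ := (Finset.univ.filter fun r => i r = 1).card

theorem ones_le (i : Fin n → Fin 2) : ones i ≤ n := by
  simpa [ones] using Finset.card_le_univ (Finset.univ.filter fun r => i r = 1)

theorem opH_apply (v : QubitSpace n) (i : Fin n → Fin 2) :
    opH n v i = ((n : ℂ) - 2 * ones i) * v i := by
  have h : ∀ r, siteOp r hMat v i = (1 - 2 * if i r = 1 then (1 : ℂ) else 0) * v i := by
    intro r
    rw [siteOp_apply, Fin.sum_univ_two]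
    have hu : v i = v (Function.update i r (i r)) := by rw [Function.update_eq_self]
    rw [hu]
    generalize i r = a
    fin_cases a <;> simp [hMat]; norm_num
  rw [opH, sumOp, LinearMap.sum_apply, WithLp.ofLp_sum, Finset.sum_apply]
  rw [Finset.sum_congr rfl fun r _ => h r, ← Finset.sum_mul, Finset.sum_sub_distrib,
    ← Finset.mul_sum, Finset.sum_boole, ones]
  simp

/-- The Casimir operator, in the normalization `4FE + H² + 2H`. -/
def casimir (n : ℕ) : Module.End ℂ (QubitSpace n) :=
  (4 : ℂ) • (opF n * opE n) + opH n * opH n + (2 : ℂ) • opH n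

theorem casimir_apply (v : QubitSpace n) : casimir n v =
    (4 : ℂ) • opF n (opE n v) + opH n (opH n v) + (2 : ℂ) • opH n v := rfl

theorem inner_casimir (v w : QubitSpace n) : ⟪casimir n v, w⟫_ℂ = ⟪v, casimir n w⟫_ℂ := by
  simp only [casimir_apply, inner_add_left, inner_add_right, inner_smul_left, inner_smul_right,
    inner_opF, inner_opE, inner_opH]
  simp only [map_ofNat]

theorem casimir_commute_opF : Commute (casimir n) (opF n) := by
  have h1 := opE_opF_commutator (n := n)
  have h2 := opH_opF_commutator (n := n)
  rw [sub_eq_iff_eq_add] at h1 h2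
  simp only [Commute, SemiconjBy, casimir, add_mul, mul_add, smul_mul_assoc, mul_smul_comm,
    mul_assoc, h1, h2]
  simp only [← mul_assoc, h2, add_mul, smul_mul_assoc, neg_mul, smul_add, smul_neg]
  simp only [mul_assoc, h2, mul_smul_comm, mul_neg]
  module

/-! ### Subrepresentations of SU(2) as subspaces stable under raising and lowering. -/

/-- A subspace of `(ℂ²)^{⊗n}` is stable if it is invariant under raising and lowering. -/
def Stable (S : Submodule ℂ (QubitSpace n)) : Prop :=
  (∀ v ∈ S, opE n v ∈ S) ∧ ∀ v ∈ S, opF n v ∈ S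

theorem Stable.opH_mem {S : Submodule ℂ (QubitSpace n)} (hS : Stable S) {v : QubitSpace n}
    (hv : v ∈ S) : opH n v ∈ S := by
  rw [← opE_opF_commutator]
  exact S.sub_mem (hS.1 _ (hS.2 _ hv)) (hS.2 _ (hS.1 _ hv))

theorem Stable.orthogonal {S : Submodule ℂ (QubitSpace n)} (hS : Stable S) : Stable Sᗮ := by
  refine ⟨fun v hv => ?_, fun v hv => ?_⟩ <;> rw [Submodule.mem_orthogonal] at hv ⊢ <;> intro u hu
  · rw [← inner_opF]
    exact hv _ (hS.2 _ hu)
  · rw [← inner_opE]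
    exact hv _ (hS.1 _ hu)

/-- The product rule at `U 0 = 1` leaves one differentiated factor in each term. Matrix elements are
used so that only scalar functions are differentiated. -/
theorem hasDerivAt_tensorOp {U : ℝ → Matrix (Fin 2) (Fin 2) ℂ} {A : Matrix (Fin 2) (Fin 2) ℂ}
    (hU : U 0 = 1) (hd : ∀ a b, HasDerivAt (fun t => U t a b) (A a b) 0) (v w : QubitSpace n) :
    HasDerivAt (fun t => ⟪w, tensorOp (fun _ : Fin n => U t) v⟫_ℂ)
      ⟪w, sumOp Finset.univ A v⟫_ℂ 0 := by
  have key : ∀ i j : Fin n → Fin 2, HasDerivAt (fun t => ∏ r, U t (i r) (j r))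
      (∑ r, ∏ s, Function.update (1 : Fin n → Matrix (Fin 2) (Fin 2) ℂ) r A s (i s) (j s)) 0 := by
    intro i j
    have := HasDerivAt.fun_finsetProd (u := Finset.univ) (fun (r : Fin n) _ => hd (i r) (j r))
    refine this.congr_deriv (Finset.sum_congr rfl fun r _ => ?_)
    rw [prod_update_one, hU, smul_eq_mul, mul_comm]
  simp only [PiLp.inner_apply, RCLike.inner_apply, tensorOp_apply, sumOp, LinearMap.sum_apply,
    WithLp.ofLp_sum, Finset.sum_apply, siteOp]
  refine HasDerivAt.fun_sum fun i _ => HasDerivAt.mul_const ?_ _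
  rw [Finset.sum_comm]
  refine HasDerivAt.fun_sum fun j _ => ?_
  rw [← Finset.sum_mul]
  exact (key i j).mul_const _

/-- Matrix elements between the subspace and its orthogonal complement vanish along the whole curve,
hence so does their derivative at `0`. -/
theorem sumOp_mem_of_invariant (σ : Subrepresentation (tensorRep n))
    {U : ℝ → Matrix (Fin 2) (Fin 2) ℂ} {A : Matrix (Fin 2) (Fin 2) ℂ}
    (hSU : ∀ t, U t ∈ Matrix.specialUnitaryGroup (Fin 2) ℂ)
    (hU : U 0 = 1) (hd : ∀ a b, HasDerivAt (fun t => U t a b) (A a b) 0) {v : QubitSpace n}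
    (hv : v ∈ σ.toSubmodule) : sumOp Finset.univ A v ∈ σ.toSubmodule := by
  rw [← Submodule.orthogonal_orthogonal σ.toSubmodule, Submodule.mem_orthogonal]
  intro w hw
  have h := hasDerivAt_tensorOp hU hd v w
  have h0 : (fun t => ⟪w, tensorOp (fun _ : Fin n => U t) v⟫_ℂ) = fun _ => 0 := by
    ext t
    exact (Submodule.mem_orthogonal' _ _).1 hw _ (σ.apply_mem_toSubmodule ⟨U t, hSU t⟩ hv)
  rw [h0] at h
  exact h.unique (hasDerivAt_const _ _)

theorem rotation_mem (t : ℝ) {z : ℂ} (hz : z * star z = 1) :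
    !![(Real.cos t : ℂ), -star z * Real.sin t; z * Real.sin t, (Real.cos t : ℂ)] ∈
      Matrix.specialUnitaryGroup (Fin 2) ℂ := by
  have h : (Real.cos t : ℂ) * Real.cos t + Real.sin t * Real.sin t = 1 := by
    exact_mod_cast (by nlinarith [Real.sin_sq_add_cos_sq t] :
      Real.cos t * Real.cos t + Real.sin t * Real.sin t = 1)
  rw [RCLike.star_def] at *
  rw [Matrix.mem_specialUnitaryGroup_iff, Matrix.mem_unitaryGroup_iff]
  constructor
  · ext i j
    fin_cases i <;> fin_cases j <;>
      simp [Matrix.mul_apply, Fin.sum_univ_two, -Complex.ofReal_cos, -Complex.ofReal_sin]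
    · linear_combination h + Real.sin t * Real.sin t * hz
    · ring
    · ring
    · linear_combination h + Real.sin t * Real.sin t * hz
  · rw [Matrix.det_fin_two_of]
    linear_combination h + Real.sin t * Real.sin t * hz

theorem rotation_hasDerivAt (z : ℂ) (a b : Fin 2) :
    HasDerivAt (fun t : ℝ => !![(Real.cos t : ℂ), -star z * Real.sin t;
      z * Real.sin t, (Real.cos t : ℂ)] a b) ((z • fMat - star z • eMat) a b) 0 := by
  have hc : HasDerivAt (fun t : ℝ => (Real.cos t : ℂ)) 0 0 := by
    simpa using (Real.hasDerivAt_cos 0).ofReal_comp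
  have hs : HasDerivAt (fun t : ℝ => (Real.sin t : ℂ)) 1 0 := by
    simpa using (Real.hasDerivAt_sin 0).ofReal_comp
  fin_cases a <;> fin_cases b
  · simpa [fMat, eMat, -Complex.ofReal_cos] using hc
  · simpa [fMat, eMat, -Complex.ofReal_sin] using hs.const_mul (-star z)
  · simpa [fMat, eMat, -Complex.ofReal_sin] using hs.const_mul z
  · simpa [fMat, eMat, -Complex.ofReal_cos] using hc

/-- The rotations have generators `zF - z̄E` with `|z| = 1`. The choices `z = 1` and `z = i` give `F
- E` and `i(F + E)`, whose complex span contains `E` and `F`. -/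
theorem stable_of_subrepresentation (σ : Subrepresentation (tensorRep n)) :
    Stable σ.toSubmodule := by
  have key : ∀ z : ℂ, z * star z = 1 → ∀ v ∈ σ.toSubmodule,
      z • opF n v - star z • opE n v ∈ σ.toSubmodule := by
    intro z hz v hv
    have h := sumOp_mem_of_invariant σ (fun t => rotation_mem t hz)
      (by ext i j; fin_cases i <;> fin_cases j <;> simp) (rotation_hasDerivAt z) hv
    rwa [sumOp_sub, sumOp_smul, sumOp_smul] at h
  have h1 := fun v hv => key 1 (by simp) v hv
  have h2 := fun v hv => key Complex.I (by simp) v hv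
  refine ⟨fun v hv => ?_, fun v hv => ?_⟩
  · have h := σ.toSubmodule.smul_mem (-(2 : ℂ)⁻¹) (σ.toSubmodule.add_mem (h1 v hv)
      (σ.toSubmodule.smul_mem Complex.I (h2 v hv)))
    convert h using 1
    simp only [smul_sub, smul_add, smul_smul, star_one, RCLike.star_def, Complex.conj_I]
    ring_nf
    simp only [Complex.I_sq]
    module
  · have h := σ.toSubmodule.smul_mem ((2 : ℂ)⁻¹) (σ.toSubmodule.sub_mem (h1 v hv)
      (σ.toSubmodule.smul_mem Complex.I (h2 v hv)))
    convert h using 1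
    simp only [smul_sub, smul_smul, star_one, RCLike.star_def, Complex.conj_I]
    ring_nf
    simp only [Complex.I_sq]
    module

theorem isNilpotent_sumOp {A : Matrix (Fin 2) (Fin 2) ℂ} (hA : A * A = 0)
    (s : Finset (Fin n)) : IsNilpotent (sumOp s A) := by
  refine Commute.isNilpotent_sum (fun r _ => ⟨2, ?_⟩) fun r r' _ _ => ?_
  · rw [pow_two, siteOp_mul, hA, ← zero_smul ℂ A, siteOp_smul, zero_smul]
  · by_cases h : r = r'
    · subst h; exact Commute.refl _
    · exact siteOp_commute h A A

/-- When `A² = 0`, `1 + A` is the exponential of `A`; exponentials at different sites commute and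
multiply to the exponential of the sum. -/
theorem tensorOp_eq_exp {A : Matrix (Fin 2) (Fin 2) ℂ} (hA : A * A = 0)
    (s : Finset (Fin n)) :
    tensorOp (s.piecewise (fun _ => 1 + A) 1) = IsNilpotent.exp (sumOp s A) := by
  induction s using Finset.induction_on with
  | empty => simp [sumOp, tensorOp_one]
  | insert r s hr ih =>
    have h1 : sumOp (insert r s) A = sumOp {r} A + sumOp s A := by
      simp [sumOp, Finset.sum_insert hr]
    have h2 : sumOp {r} A ^ 2 = 0 := by
      rw [sumOp, Finset.sum_singleton, pow_two, siteOp_mul, hA, ← zero_smul ℂ A, siteOp_smul,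
        zero_smul]
    rw [h1, IsNilpotent.exp_add_of_commute
      (sumOp_commute (Finset.disjoint_singleton_left.2 hr) A A) (isNilpotent_sumOp hA _)
      (isNilpotent_sumOp hA _), ← ih, IsNilpotent.exp_eq_sum h2]
    have h3 : ∑ i ∈ Finset.range 2, (i.factorial : ℚ)⁻¹ • sumOp {r} A ^ i
        = tensorOp (Function.update 1 r (1 + A)) := by
      rw [← siteOp, siteOp_add, siteOp_one]
      simp [Finset.sum_range_succ, sumOp]
    rw [h3, ← tensorOp_mul]
    congr 1
    ext1 t
    by_cases ht : t = r
    · subst ht; simp [hr]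
    · simp [Finset.piecewise, ht]

theorem tensorOp_unipotent_mem {A : Matrix (Fin 2) (Fin 2) ℂ} (hA : A * A = 0)
    {S : Submodule ℂ (QubitSpace n)} (hS : ∀ v ∈ S, sumOp Finset.univ A v ∈ S)
    {v : QubitSpace n} (hv : v ∈ S) : tensorOp (fun _ => 1 + A) v ∈ S := by
  have h := tensorOp_eq_exp hA (Finset.univ : Finset (Fin n))
  rw [Finset.piecewise_univ] at h
  rw [h, IsNilpotent.exp, LinearMap.sum_apply]
  refine S.sum_mem fun k _ => ?_
  have hk : ∀ k : ℕ, (sumOp Finset.univ A ^ k) v ∈ S := by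
    intro k
    induction k with
    | zero => simpa using hv
    | succ k ih => rw [pow_succ']; exact hS _ ih
  rw [LinearMap.smul_apply]
  have : ((k.factorial : ℚ)⁻¹ • (sumOp Finset.univ A ^ k) v)
      = ((k.factorial : ℂ)⁻¹ • (sumOp Finset.univ A ^ k) v) := by
    rw [← Rat.cast_smul_eq_qsmul ℂ]
    simp
  rw [this]
  exact S.smul_mem _ (hk k)

/-- `SL(2)` is generated by the unipotents `1 + tE` and `1 + tF`, whose tensor powers are
polynomials in the total `E` or `F`. No integration over the compact group is needed. -/
theorem Stable.tensorOp_mem {S : Submodule ℂ (QubitSpace n)} (hS : Stable S)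
    {U : Matrix (Fin 2) (Fin 2) ℂ} (hU : U.det = 1) {v : QubitSpace n} (hv : v ∈ S) :
    tensorOp (fun _ => U) v ∈ S := by
  have hE : ∀ (t : ℂ) (v : QubitSpace n), v ∈ S →
      tensorOp (fun _ => 1 + t • eMat) v ∈ S := by
    intro t v hv
    refine tensorOp_unipotent_mem (by simp [eMat_mul_eMat]) (fun v hv => ?_) hv
    rw [sumOp_smul]
    exact S.smul_mem _ (hS.1 _ hv)
  have hF : ∀ (t : ℂ) (v : QubitSpace n), v ∈ S →
      tensorOp (fun _ => 1 + t • fMat) v ∈ S := by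
    intro t v hv
    refine tensorOp_unipotent_mem (by simp [fMat_mul_fMat]) (fun v hv => ?_) hv
    rw [sumOp_smul]
    exact S.smul_mem _ (hS.2 _ hv)
  have hmul : ∀ (A B : Matrix (Fin 2) (Fin 2) ℂ) (v : QubitSpace n),
      tensorOp (fun _ => A * B) v = tensorOp (fun _ => A) (tensorOp (fun _ => B) v) := by
    intro A B v
    rw [← Module.End.mul_apply, ← tensorOp_mul]
    rfl
  rw [Matrix.det_fin_two] at hU
  have key : ∀ (U : Matrix (Fin 2) (Fin 2) ℂ), U 0 0 * U 1 1 - U 0 1 * U 1 0 = 1 → U 1 0 ≠ 0 →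
      ∀ v ∈ S, tensorOp (fun _ => U) v ∈ S := by
    intro U hU h0 v hv
    have : U = (1 + ((U 0 0 - 1) / U 1 0) • eMat) * (1 + U 1 0 • fMat)
        * (1 + ((U 1 1 - 1) / U 1 0) • eMat) := by
      ext i j
      fin_cases i <;> fin_cases j <;>
        simp [Matrix.mul_apply, Fin.sum_univ_two, eMat, fMat] <;> field_simp
      · ring
      · linear_combination -hU
      · ring
    rw [this, hmul, hmul]
    exact hE _ _ (hF _ _ (hE _ _ hv))
  by_cases h0 : U 1 0 = 0
  -- Multiplying by `1 + F` makes the lower left entry equal to `U 0 0`, which is nonzero because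
  -- the determinant is 1; `1 - F` undoes this.
  · have : U = (1 + (-1 : ℂ) • fMat) * ((1 + (1 : ℂ) • fMat) * U) := by
      rw [← mul_assoc]
      convert (one_mul U).symm
      ext i j
      fin_cases i <;> fin_cases j <;> simp [Matrix.mul_apply, Fin.sum_univ_two, fMat]
    rw [this, hmul]
    refine hF _ _ (key _ ?_ ?_ v hv)
    · simp [Matrix.mul_apply, Fin.sum_univ_two, fMat, h0]
      linear_combination hU + U 0 1 * h0
    · simp [Matrix.mul_apply, Fin.sum_univ_two, fMat, h0]
      rintro h
      simp [h, h0] at hU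
  · exact key U hU h0 v hv

/-- A stable subspace as a subrepresentation. -/
def Stable.toSubrepresentation {S : Submodule ℂ (QubitSpace n)} (hS : Stable S) :
    Subrepresentation (tensorRep n) where
  toSubmodule := S
  apply_mem_toSubmodule U _ hv :=
    hS.tensorOp_mem (Matrix.mem_specialUnitaryGroup_iff.1 U.2).2 hv

theorem isIrreducible_iff (σ : Subrepresentation (tensorRep n)) :
    σ.toRepresentation.IsIrreducible ↔ σ.toSubmodule ≠ ⊥ ∧
      ∀ S : Submodule ℂ (QubitSpace n), Stable S → S ≤ σ.toSubmodule → S = ⊥ ∨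
        S = σ.toSubmodule := by
  constructor
  · intro h
    refine ⟨fun hbot => ?_, fun S hS hle => ?_⟩
    · obtain ⟨a, b, hab⟩ := h.toNontrivial
      refine hab (Subrepresentation.ext (Submodule.ext fun x => ?_))
      have : x = 0 := Subtype.ext ((Submodule.mem_bot ℂ).1 (hbot ▸ x.2))
      subst this
      simp
    · let τ : Subrepresentation σ.toRepresentation :=
        { toSubmodule := S.comap σ.toSubmodule.subtype
          apply_mem_toSubmodule := fun g v hv =>
            hS.toSubrepresentation.apply_mem_toSubmodule g hv }
      have hmap : τ.toSubmodule.map σ.toSubmodule.subtype = S := by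
        simp only [τ, Submodule.map_comap_subtype]
        exact inf_eq_right.2 hle
      rcases h.eq_bot_or_eq_top τ with h | h
      · left
        rw [← hmap, h]
        exact Submodule.map_bot _
      · right
        rw [← hmap, h]
        exact Submodule.map_subtype_top _
  · rintro ⟨hne, hmin⟩
    refine { exists_pair_ne := ⟨⊥, ⊤, fun h => hne ?_⟩, eq_bot_or_eq_top := fun τ => ?_ }
    · have h' : (⊥ : Submodule ℂ σ.toSubmodule) = ⊤ := congrArg Subrepresentation.toSubmodule h
      rw [← Submodule.map_subtype_top σ.toSubmodule, ← h', Submodule.map_bot]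
    · let ρ : Subrepresentation (tensorRep n) :=
        { toSubmodule := τ.toSubmodule.map σ.toSubmodule.subtype
          apply_mem_toSubmodule := by
            rintro g _ ⟨v, hv, rfl⟩
            exact ⟨_, τ.apply_mem_toSubmodule g hv, rfl⟩ }
      have hinj := Submodule.map_injective_of_injective σ.toSubmodule.subtype_injective
      rcases hmin ρ.toSubmodule (stable_of_subrepresentation ρ) (Submodule.map_subtype_le _ _)
        with h | h
      · left
        refine Subrepresentation.ext (hinj ?_)
        exact h.trans (Submodule.map_bot _).symm
      · right
        refine Subrepresentation.ext (hinj ?_)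
        exact h.trans (Submodule.map_subtype_top _).symm

/-! ### Highest weight vectors and irreducible subrepresentations. -/

theorem opH_pow_opF {v : QubitSpace n} {c : ℂ} (hH : opH n v = c • v) (k : ℕ) :
    opH n ((opF n ^ k) v) = (c - 2 * k) • (opF n ^ k) v := by
  induction k with
  | zero => simpa using hH
  | succ k ih =>
    have h := LinearMap.congr_fun (opH_opF_commutator (n := n)) ((opF n ^ k) v)
    simp only [LinearMap.sub_apply, Module.End.mul_apply, LinearMap.neg_apply,
      LinearMap.smul_apply, ih, map_smul, sub_eq_iff_eq_add] at h
    rw [pow_succ', Module.End.mul_apply, h]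
    push_cast
    module

/-- Moving `E` past each `F` contributes one of the weights `c, c-2, …, c-2k`, whose sum is
`(k+1)(c-k)`. -/
theorem opE_pow_succ_opF {v : QubitSpace n} {c : ℂ} (hH : opH n v = c • v)
    (hE : opE n v = 0) (k : ℕ) :
    opE n ((opF n ^ (k + 1)) v) = ((k + 1) * (c - k)) • (opF n ^ k) v := by
  induction k with
  | zero =>
    have h := LinearMap.congr_fun (opE_opF_commutator (n := n)) v
    simp only [LinearMap.sub_apply, Module.End.mul_apply, hE, map_zero, sub_zero, hH] at h
    simpa using h
  | succ k ih =>
    have h := LinearMap.congr_fun (opE_opF_commutator (n := n)) ((opF n ^ (k + 1)) v)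
    simp only [LinearMap.sub_apply, Module.End.mul_apply, ih, opH_pow_opF hH, map_smul,
      sub_eq_iff_eq_add] at h
    rw [pow_succ', Module.End.mul_apply, h, ← Module.End.mul_apply (opF n), ← pow_succ']
    push_cast
    module

/-- Nilpotency of `E` gives a nonzero kernel inside `S`. The relation `[H,E] = 2E` makes `H`
preserve it, so `H` has an eigenvector there. -/
theorem Stable.exists_highest_weight {S : Submodule ℂ (QubitSpace n)} (hS : Stable S)
    (hne : S ≠ ⊥) : ∃ v ∈ S, v ≠ 0 ∧ opE n v = 0 ∧ ∃ c : ℂ, opH n v = c • v := by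
  obtain ⟨u, huS, hu⟩ := S.ne_bot_iff.1 hne
  obtain ⟨k, hk⟩ := isNilpotent_sumOp (n := n) eMat_mul_eMat Finset.univ
  have hk' : ∃ k, (opE n ^ k) u = 0 := ⟨k, by rw [opE, hk]; rfl⟩
  obtain ⟨j, hj, hj'⟩ := Nat.exists_not_and_succ_of_not_zero_of_exists
    (p := fun k => (opE n ^ k) u = 0) (by simpa using hu) hk'
  have hpow : ∀ j : ℕ, (opE n ^ j) u ∈ S := by
    intro j
    induction j with
    | zero => simpa using huS
    | succ j ih => rw [pow_succ']; exact hS.1 _ ih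
  let K : Submodule ℂ (QubitSpace n) := S ⊓ LinearMap.ker (opE n)
  have hHK : ∀ v ∈ K, opH n v ∈ K := by
    rintro v ⟨hv, hv'⟩
    refine ⟨hS.opH_mem hv, ?_⟩
    have hv'' : opE n v = 0 := hv'
    have h := LinearMap.congr_fun (opH_opE_commutator (n := n)) v
    simp only [LinearMap.sub_apply, Module.End.mul_apply, LinearMap.smul_apply, hv'', map_zero,
      zero_sub, smul_zero, neg_eq_zero] at h
    exact h
  have hK : (opE n ^ j) u ∈ K := by
    refine ⟨hpow j, ?_⟩
    rw [pow_succ'] at hj'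
    exact hj'
  have : Nontrivial K := ⟨⟨_, hK⟩, 0, fun h => hj (congrArg Subtype.val h)⟩
  obtain ⟨c, hc⟩ := Module.End.exists_eigenvalue ((opH n).restrict hHK)
  obtain ⟨w, hw⟩ := hc.exists_hasEigenvector
  exact ⟨w, w.2.1, fun h => hw.2 (Subtype.ext h), w.2.2, c,
    congrArg Subtype.val hw.apply_eq_smul⟩

theorem exists_weight {v : QubitSpace n} (hv : v ≠ 0) {c : ℂ} (hH : opH n v = c • v) :
    ∃ p ≤ n, c = n - 2 * (p : ℂ) := by
  obtain ⟨i, hi⟩ : ∃ i, v i ≠ 0 := by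
    by_contra! h
    exact hv (by ext i; simpa using h i)
  have h := congrArg (fun w : QubitSpace n => w i) hH
  simp only [opH_apply, PiLp.smul_apply, smul_eq_mul] at h
  exact ⟨ones i, ones_le i, (mul_right_cancel₀ hi h).symm⟩

theorem casimir_highest_weight {v : QubitSpace n} {c : ℂ} (hH : opH n v = c • v)
    (hE : opE n v = 0) : casimir n v = (c * (c + 2)) • v := by
  rw [casimir_apply, hE, map_zero, hH, map_smul, hH]
  module

/-- The value of the Casimir operator on the isotypical component of index `x`. -/
def casimirValue (n x : ℕ) : ℝ := ((n : ℝ) - 2 * x) * ((n : ℝ) - 2 * x + 2)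

/-- The vectors `v, Fv, …, F^d v` below a highest weight vector span a stable subspace, which
irreducibility makes everything. They have distinct weights, so the dimension is `d + 1`; the
Casimir operator commutes with `F`, so its value at `v` holds throughout. -/
theorem irreducible_finrank_casimir {σ : Subrepresentation (tensorRep n)}
    (hσ : σ.toRepresentation.IsIrreducible) :
    ∃ x ≤ n / 2, Module.finrank ℂ σ.toSubmodule = n - 2 * x + 1 ∧
      ∀ v ∈ σ.toSubmodule, casimir n v = (casimirValue n x : ℂ) • v := by
  obtain ⟨hne, hmin⟩ := (isIrreducible_iff σ).1 hσ
  have hst := stable_of_subrepresentation σ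
  obtain ⟨v, hvσ, hv, hE, c, hH⟩ := hst.exists_highest_weight hne
  obtain ⟨k, hk⟩ := isNilpotent_sumOp (n := n) fMat_mul_fMat Finset.univ
  have hk' : ∃ k, (opF n ^ k) v = 0 := ⟨k, by rw [opF, hk]; rfl⟩
  obtain ⟨d, hd, hd'⟩ := Nat.exists_not_and_succ_of_not_zero_of_exists
    (p := fun k => (opF n ^ k) v = 0) (by simpa using hv) hk'
  -- As `F^(d+1) v = 0`, applying `E` gives `(d+1)(c-d) F^d v = 0` with `F^d v ≠ 0`.
  have hcd : c = d := by
    have h := opE_pow_succ_opF hH hE d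
    rw [hd', map_zero, eq_comm, smul_eq_zero] at h
    rcases mul_eq_zero.1 (h.resolve_right hd) with h | h
    · exact absurd h (Nat.cast_add_one_ne_zero d)
    · exact sub_eq_zero.1 h
  obtain ⟨p, hp, hcp⟩ := exists_weight hv hH
  have hdp : d + 2 * p = n := by
    have : (d : ℂ) + 2 * p = n := by rw [← hcd, hcp]; ring
    exact_mod_cast this
  have hnz : ∀ j ≤ d, (opF n ^ j) v ≠ 0 := by
    intro j hj h0
    apply hd
    rw [← Nat.sub_add_cancel hj, pow_add, Module.End.mul_apply, h0, map_zero]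
  have hz : ∀ j > d, (opF n ^ j) v = 0 := by
    intro j hj
    rw [← Nat.sub_add_cancel (Nat.succ_le_of_lt hj), pow_add, Module.End.mul_apply, hd', map_zero]
  let ψ : Fin (d + 1) → QubitSpace n := fun j => (opF n ^ (j : ℕ)) v
  let S : Submodule ℂ (QubitSpace n) := Submodule.span ℂ (Set.range ψ)
  have hψ : ∀ j : ℕ, (opF n ^ j) v ∈ S := by
    intro j
    rcases le_or_gt j d with hj | hj
    · exact Submodule.subset_span ⟨⟨j, Nat.lt_succ_of_le hj⟩, rfl⟩
    · rw [hz j hj]; exact S.zero_mem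
  have hSst : Stable S := by
    refine ⟨fun w hw => ?_, fun w hw => ?_⟩
    · have : S ≤ S.comap (opE n) := by
        refine Submodule.span_le.2 ?_
        rintro _ ⟨⟨j, hj⟩, rfl⟩
        change opE n ((opF n ^ j) v) ∈ S
        cases j with
        | zero => simp [hE]
        | succ j =>
          rw [opE_pow_succ_opF hH hE]
          exact S.smul_mem _ (hψ j)
      exact this hw
    · have : S ≤ S.comap (opF n) := by
        refine Submodule.span_le.2 ?_
        rintro _ ⟨⟨j, hj⟩, rfl⟩
        change opF n ((opF n ^ j) v) ∈ S
        rw [← Module.End.mul_apply, ← pow_succ']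
        exact hψ _
      exact this hw
  have hSσ : S ≤ σ.toSubmodule := by
    have hpow : ∀ j : ℕ, (opF n ^ j) v ∈ σ.toSubmodule := by
      intro j
      induction j with
      | zero => simpa using hvσ
      | succ j ih => rw [pow_succ']; exact hst.2 _ ih
    refine Submodule.span_le.2 ?_
    rintro _ ⟨j, rfl⟩
    exact hpow j
  have hS : S = σ.toSubmodule := by
    refine (hmin S hSst hSσ).resolve_left fun h => hv ?_
    have := hψ 0
    rw [h] at this
    simpa using this
  refine ⟨p, by omega, ?_, ?_⟩
  · have hli : LinearIndependent ℂ ψ := by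
      refine Module.End.eigenvectors_linearIndependent' (opH n)
        (fun j : Fin (d + 1) => c - 2 * (j : ℕ)) ?_ ψ fun j => ?_
      · intro a b hab
        have : ((a : ℕ) : ℂ) = (b : ℕ) := by linear_combination -(1 / 2 : ℂ) * hab
        exact Fin.ext (by exact_mod_cast this)
      · exact ⟨Module.End.mem_eigenspace_iff.2 (opH_pow_opF hH j),
          hnz j (Nat.le_of_lt_succ j.2)⟩
    rw [← hS, finrank_span_eq_card hli, Fintype.card_fin]
    omega
  · rw [← hS]
    intro w hw
    have hle : S ≤ LinearMap.ker (casimir n - (casimirValue n p : ℂ) • 1) := by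
      refine Submodule.span_le.2 ?_
      rintro _ ⟨j, rfl⟩
      change casimir n ((opF n ^ (j : ℕ)) v) - (casimirValue n p : ℂ) • (opF n ^ (j : ℕ)) v = 0
      rw [← Module.End.mul_apply, (casimir_commute_opF.pow_right j).eq, Module.End.mul_apply,
        casimir_highest_weight hH hE, map_smul, ← sub_smul, hcp, casimirValue]
      push_cast
      rw [sub_self, zero_smul]
    exact sub_eq_zero.1 (hle hw)

/-! ### Isotypical decomposition and spectral resolution of the Casimir operator. -/

theorem casimir_isotypicalComponent {x : ℕ} (hx : x ≤ n / 2) {v : QubitSpace n}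
    (hv : v ∈ isotypicalComponent n x) : casimir n v = (casimirValue n x : ℂ) • v := by
  have hle : isotypicalComponent n x ≤
      LinearMap.ker (casimir n - (casimirValue n x : ℂ) • 1) := by
    refine iSup_le fun σ => iSup_le fun hσ => iSup_le fun hd w hw => ?_
    obtain ⟨y, hy, hdy, hc⟩ := irreducible_finrank_casimir hσ
    obtain rfl : y = x := by omega
    exact sub_eq_zero.2 (hc w hw)
  exact sub_eq_zero.1 (hle hv)

theorem casimirValue_injOn {x y : ℕ} (hx : x ≤ n / 2) (hy : y ≤ n / 2)
    (h : casimirValue n x = casimirValue n y) : x = y := by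
  have hx' : (2 : ℝ) * x ≤ n := by exact_mod_cast (by omega : 2 * x ≤ n)
  have hy' : (2 : ℝ) * y ≤ n := by exact_mod_cast (by omega : 2 * y ≤ n)
  unfold casimirValue at h
  -- The second factor is at least 2, because `2x` and `2y` are at most `n`.
  have h2 : ((y : ℝ) - x) * (2 * n - 2 * x - 2 * y + 2) = 0 := by linear_combination h / 2
  rcases mul_eq_zero.1 h2 with h2 | h2
  · exact_mod_cast (sub_eq_zero.1 h2).symm
  · linarith

theorem isotypicalComponent_orthogonal {x y : ℕ} (hx : x ≤ n / 2) (hy : y ≤ n / 2) (hxy : x ≠ y)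
    {v w : QubitSpace n} (hv : v ∈ isotypicalComponent n x)
    (hw : w ∈ isotypicalComponent n y) : ⟪v, w⟫_ℂ = 0 := by
  have h := inner_casimir v w
  rw [casimir_isotypicalComponent hx hv, casimir_isotypicalComponent hy hw, inner_smul_left,
    inner_smul_right, Complex.conj_ofReal, ← sub_eq_zero, ← sub_mul] at h
  refine (mul_eq_zero.1 h).resolve_left fun h => hxy (casimirValue_injOn hx hy ?_)
  exact_mod_cast sub_eq_zero.1 h

theorem Stable.exists_irreducible {S : Submodule ℂ (QubitSpace n)} (hS : Stable S)
    (hne : S ≠ ⊥) : ∃ σ : Subrepresentation (tensorRep n),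
      σ.toRepresentation.IsIrreducible ∧ σ.toSubmodule ≤ S := by
  obtain ⟨T, ⟨hT, hT0, hTS⟩, hmin⟩ := (wellFounded_lt (α := Submodule ℂ (QubitSpace n))).has_min
    {T | Stable T ∧ T ≠ ⊥ ∧ T ≤ S} ⟨S, hS, hne, le_rfl⟩
  refine ⟨hT.toSubrepresentation, (isIrreducible_iff _).2 ⟨hT0, fun R hR hRT => ?_⟩, hTS⟩
  by_contra! h
  exact hmin R ⟨hR, h.1, le_trans hRT hTS⟩ (lt_of_le_of_ne hRT h.2)

theorem Stable.iSup {ι : Sort*} {S : ι → Submodule ℂ (QubitSpace n)} (hS : ∀ i, Stable (S i)) :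
    Stable (⨆ i, S i) := by
  refine ⟨fun v hv => ?_, fun v hv => ?_⟩
  · exact (iSup_le fun i w hw => Submodule.mem_iSup_of_mem i ((hS i).1 w hw) :
      ⨆ i, S i ≤ (⨆ i, S i).comap (opE n)) hv
  · exact (iSup_le fun i w hw => Submodule.mem_iSup_of_mem i ((hS i).2 w hw) :
      ⨆ i, S i ≤ (⨆ i, S i).comap (opF n)) hv

/-- If the sum were proper, its orthogonal complement would be stable and nonzero and so contain an
irreducible, which already lies in some component. -/
theorem iSup_isotypicalComponent :
    ⨆ x : Fin (n / 2 + 1), isotypicalComponent n x = ⊤ := by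
  have hst : Stable (⨆ x : Fin (n / 2 + 1), isotypicalComponent n x) :=
    Stable.iSup fun x => Stable.iSup fun σ => Stable.iSup fun _ => Stable.iSup fun _ =>
      stable_of_subrepresentation σ
  by_contra hne
  obtain ⟨σ, hσ, hle⟩ := hst.orthogonal.exists_irreducible
    fun h => hne (Submodule.orthogonal_eq_bot_iff.1 h)
  obtain ⟨x, hx, hd, -⟩ := irreducible_finrank_casimir hσ
  have hle' : σ.toSubmodule ≤ ⨆ x : Fin (n / 2 + 1), isotypicalComponent n x :=
    le_trans (le_iSup₂_of_le σ hσ (le_iSup (fun _ : _ = _ => σ.toSubmodule) hd))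
      (le_iSup (fun x : Fin (n / 2 + 1) => isotypicalComponent n x) ⟨x, by omega⟩)
  refine ((isIrreducible_iff σ).1 hσ).1 (le_bot_iff.1 ?_)
  rw [← Submodule.inf_orthogonal_eq_bot (⨆ x : Fin (n / 2 + 1), isotypicalComponent n x)]
  exact le_inf hle' hle

theorem orthogonalFamily_isotypicalComponent : OrthogonalFamily ℂ
    (fun x : Fin (n / 2 + 1) => isotypicalComponent n x)
    fun x => (isotypicalComponent n x).subtypeₗᵢ := by
  intro x y hxy v w
  exact isotypicalComponent_orthogonal (Nat.le_of_lt_succ x.2) (Nat.le_of_lt_succ y.2)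
    (fun h => hxy (Fin.ext h)) v.2 w.2

theorem sum_starProjection_isotypicalComponent (v : QubitSpace n) :
    ∑ x : Fin (n / 2 + 1), (isotypicalComponent n x).starProjection v = v :=
  orthogonalFamily_isotypicalComponent.sum_projection_of_mem_iSup v
    (by rw [iSup_isotypicalComponent]; trivial)

theorem re_inner_starProjection (K : Submodule ℂ (QubitSpace n)) (v : QubitSpace n) :
    (⟪v, K.starProjection v⟫_ℂ).re = ‖K.starProjection v‖ ^ 2 := by
  have h := K.starProjection_inner_eq_zero v _ (K.starProjection_apply_mem v)
  rw [inner_sub_left, sub_eq_zero] at h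
  rw [h]
  exact inner_self_eq_norm_sq (𝕜 := ℂ) _

/-- Spectral decomposition of the second moment of the Casimir operator about a real number. -/
theorem sum_sq_mul_inner_starProjection (v : QubitSpace n) (c : ℝ) :
    ∑ x ∈ Finset.range (n / 2 + 1), (casimirValue n x - c) ^ 2 *
      (⟪v, (isotypicalComponent n x).starProjection v⟫_ℂ).re =
      ‖casimir n v - (c : ℂ) • v‖ ^ 2 := by
  have hmem : ∀ x, (isotypicalComponent n x).starProjection v ∈ isotypicalComponent n x :=
    fun x => Submodule.starProjection_apply_mem _ _
  have hcas : casimir n v - (c : ℂ) • v = ∑ x : Fin (n / 2 + 1),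
      ((casimirValue n x - c : ℝ) : ℂ) • (isotypicalComponent n x).starProjection v := by
    have hv := sum_starProjection_isotypicalComponent v
    conv_lhs => rw [← hv]
    rw [map_sum, Finset.smul_sum, ← Finset.sum_sub_distrib]
    refine Finset.sum_congr rfl fun x _ => ?_
    rw [casimir_isotypicalComponent (Nat.le_of_lt_succ x.2) (hmem x), ← sub_smul]
    push_cast
    rfl
  have hnorm := OrthogonalFamily.norm_sum orthogonalFamily_isotypicalComponent (fun x =>
    ((casimirValue n x - c : ℝ) : ℂ) • (⟨_, hmem x⟩ : isotypicalComponent n x)) Finset.univ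
  rw [hcas]
  refine Eq.trans ?_ hnorm.symm
  rw [Finset.sum_range]
  refine Finset.sum_congr rfl fun x _ => ?_
  rw [norm_smul, mul_pow, Complex.norm_real, Real.norm_eq_abs, sq_abs, re_inner_starProjection]
  rfl

theorem sum_inner_starProjection (v : QubitSpace n) :
    ∑ x ∈ Finset.range (n / 2 + 1),
      (⟪v, (isotypicalComponent n x).starProjection v⟫_ℂ).re = ‖v‖ ^ 2 := by
  rw [Finset.sum_range fun x => (⟪v, (isotypicalComponent n x).starProjection v⟫_ℂ).re,
    ← Complex.re_sum, ← inner_sum, sum_starProjection_isotypicalComponent]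
  exact inner_self_eq_norm_sq (𝕜 := ℂ) _

/-! ### Norm estimates, and exact evaluation on symmetric tails. -/

theorem norm_siteOp_eMat_sq_add (r : Fin n) (v : QubitSpace n) :
    ‖siteOp r eMat v‖ ^ 2 + ‖siteOp r fMat v‖ ^ 2 = ‖v‖ ^ 2 := by
  have h : ⟪siteOp r eMat v, siteOp r eMat v⟫_ℂ + ⟪siteOp r fMat v, siteOp r fMat v⟫_ℂ
      = ⟪v, v⟫_ℂ := by
    rw [inner_siteOp, inner_siteOp, eMat_conjTranspose, fMat_conjTranspose,
      ← Module.End.mul_apply, ← Module.End.mul_apply, siteOp_mul, siteOp_mul, ← inner_add_right,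
      ← LinearMap.add_apply, ← siteOp_add, fMat_eMat_add, siteOp_one, Module.End.one_apply]
  rw [inner_self_eq_norm_sq_to_K, inner_self_eq_norm_sq_to_K, inner_self_eq_norm_sq_to_K] at h
  exact_mod_cast h

theorem norm_siteOp_eMat_le (r : Fin n) (v : QubitSpace n) : ‖siteOp r eMat v‖ ≤ ‖v‖ := by
  refine le_of_sq_le_sq ?_ (norm_nonneg v)
  have := norm_siteOp_eMat_sq_add r v
  nlinarith [sq_nonneg ‖siteOp r fMat v‖]

theorem norm_siteOp_fMat_le (r : Fin n) (v : QubitSpace n) : ‖siteOp r fMat v‖ ≤ ‖v‖ := by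
  refine le_of_sq_le_sq ?_ (norm_nonneg v)
  have := norm_siteOp_eMat_sq_add r v
  nlinarith [sq_nonneg ‖siteOp r eMat v‖]

theorem norm_sumOp_le {A : Matrix (Fin 2) (Fin 2) ℂ}
    (hA : ∀ (r : Fin n) (v : QubitSpace n), ‖siteOp r A v‖ ≤ ‖v‖) (s : Finset (Fin n))
    (v : QubitSpace n) : ‖sumOp s A v‖ ≤ n * ‖v‖ := by
  rw [sumOp, LinearMap.sum_apply]
  refine (norm_sum_le_of_le s fun r _ => hA r v).trans ?_
  rw [Finset.sum_const, nsmul_eq_mul]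
  refine mul_le_mul_of_nonneg_right ?_ (norm_nonneg v)
  exact_mod_cast (Finset.card_le_univ s).trans_eq (Fintype.card_fin n)

theorem siteOp_eMat_apply (r : Fin n) (v : QubitSpace n) (i : Fin n → Fin 2) :
    siteOp r eMat v i = if i r = 0 then v (Function.update i r 1) else 0 := by
  rw [siteOp_apply, Fin.sum_univ_two]
  generalize i r = a
  fin_cases a <;> simp [eMat]

theorem siteOp_fMat_apply (r : Fin n) (v : QubitSpace n) (i : Fin n → Fin 2) :
    siteOp r fMat v i = if i r = 1 then v (Function.update i r 0) else 0 := by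
  rw [siteOp_apply, Fin.sum_univ_two]
  generalize i r = a
  fin_cases a <;> simp [fMat]

theorem sumOp_apply (s : Finset (Fin n)) (A : Matrix (Fin 2) (Fin 2) ℂ) (v : QubitSpace n)
    (i : Fin n → Fin 2) : sumOp s A v i = ∑ r ∈ s, siteOp r A v i := by
  rw [sumOp, LinearMap.sum_apply, WithLp.ofLp_sum, Finset.sum_apply]

/-- The number of letters `1` of a word at the positions in `s`. -/
def onesOn (s : Finset (Fin n)) (i : Fin n → Fin 2) : ℕ := (s.filter fun r => i r = 1).card

theorem onesOn_update_zero {s : Finset (Fin n)} {r : Fin n} (hr : r ∈ s) {i : Fin n → Fin 2}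
    (hi : i r = 1) : onesOn s (Function.update i r 0) + 1 = onesOn s i := by
  have : (s.filter fun t => Function.update i r 0 t = 1) = (s.filter fun t => i t = 1).erase r := by
    ext t
    by_cases h : t = r
    · subst h; simp
    · simp [h]
  rw [onesOn, this, Finset.card_erase_add_one (by simp [hr, hi]), onesOn]

theorem onesOn_update_one {s : Finset (Fin n)} {r : Fin n} (hr : r ∈ s) {i : Fin n → Fin 2}
    (hi : i r = 0) : onesOn s (Function.update i r 1) = onesOn s i + 1 := by
  have h := onesOn_update_zero hr (i := Function.update i r 1) (by simp)
  rw [Function.update_idem, ← hi, Function.update_eq_self] at h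
  exact h.symm

theorem card_zeros (s : Finset (Fin n)) (i : Fin n → Fin 2) :
    (s.filter fun r => i r = 0).card = s.card - onesOn s i := by
  have h := Finset.card_filter_add_card_filter_not (s := s) fun r => i r = 1
  have h' : (s.filter fun r => ¬ i r = 1) = s.filter fun r => i r = 0 := by
    refine Finset.filter_congr fun r _ => ?_
    generalize i r = a
    fin_cases a <;> simp
  rw [h'] at h
  rw [onesOn]
  omega

/-- A vector whose coefficients depend only on the letters outside `s` and the number of letters
`1` in `s`, the latter being supported on a single value, is an eigenvector of `F_s E_s`. -/
theorem sumOp_fMat_sumOp_eMat {s : Finset (Fin n)} {v : QubitSpace n} {M : ℕ}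
    (hv : ∀ i j : Fin n → Fin 2, (∀ r ∉ s, i r = j r) → onesOn s i = onesOn s j → v i = v j)
    (hM : ∀ i, v i ≠ 0 → onesOn s i = M) (hMs : M ≤ s.card) :
    sumOp s fMat (sumOp s eMat v) = ((M * (s.card - M + 1) : ℝ) : ℂ) • v := by
  ext i
  have hE : ∀ j, sumOp s eMat v j =
      ∑ t ∈ s.filter (fun t => j t = 0), v (Function.update j t 1) := by
    intro j
    rw [sumOp_apply, Finset.sum_filter]
    exact Finset.sum_congr rfl fun t _ => siteOp_eMat_apply t v j
  have hF : sumOp s fMat (sumOp s eMat v) i =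
      ∑ r ∈ s.filter (fun r => i r = 1), sumOp s eMat v (Function.update i r 0) := by
    rw [sumOp_apply, Finset.sum_filter]
    exact Finset.sum_congr rfl fun t _ => siteOp_fMat_apply t _ i
  -- Turning a 1 at `r` into 0 and then any 0 of `s` into 1 keeps the count of ones in `s` and the
  -- letters outside, so each such term equals `v i`.
  have hin : ∀ r ∈ s.filter (fun r => i r = 1), sumOp s eMat v (Function.update i r 0) =
      ((s.card - (onesOn s i - 1) : ℕ) : ℂ) * v i := by
    intro r hr
    rw [Finset.mem_filter] at hr
    have h1 := onesOn_update_zero hr.1 hr.2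
    rw [hE, Finset.sum_congr rfl (g := fun _ => v i), Finset.sum_const, card_zeros, nsmul_eq_mul,
      ← h1, Nat.add_sub_cancel]
    intro t ht
    rw [Finset.mem_filter] at ht
    refine hv _ _ (fun q hq => ?_) ?_
    · have hqt : q ≠ t := fun h => hq (h ▸ ht.1)
      have hqr : q ≠ r := fun h => hq (h ▸ hr.1)
      rw [Function.update_of_ne hqt, Function.update_of_ne hqr]
    · rw [onesOn_update_one ht.1 ht.2, h1]
  rw [hF, Finset.sum_congr rfl hin, Finset.sum_const, nsmul_eq_mul, ← onesOn, PiLp.smul_apply,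
    smul_eq_mul, ← mul_assoc]
  by_cases h0 : v i = 0
  · rw [h0, mul_zero, mul_zero]
  · rw [hM i h0]
    congr 1
    -- `M = 0` is separate because the natural subtraction `M - 1` truncates.
    rcases Nat.eq_zero_or_pos M with rfl | hpos
    · simp
    · rw [Nat.cast_sub (by omega), Nat.cast_sub hpos]
      push_cast
      ring

/-- If the letters in `s` are the same for all words of the support of `v` and `A` has zero
diagonal, the vectors `A_r v` with `r ∈ s` are orthogonal. -/
theorem norm_sumOp_sq_le {A : Matrix (Fin 2) (Fin 2) ℂ}
    (hA : ∀ (r : Fin n) (v : QubitSpace n), ‖siteOp r A v‖ ≤ ‖v‖) (hdiag : ∀ a, A a a = 0)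
    {s : Finset (Fin n)} {v : QubitSpace n}
    (hv : ∀ i j : Fin n → Fin 2, v i ≠ 0 → v j ≠ 0 → ∀ r ∈ s, i r = j r) :
    ‖sumOp s A v‖ ^ 2 ≤ n * ‖v‖ ^ 2 := by
  have hne : ∀ r i, siteOp r A v i ≠ 0 → ∃ a ≠ i r, v (Function.update i r a) ≠ 0 := by
    intro r i h
    rw [siteOp_apply] at h
    obtain ⟨a, -, ha⟩ := Finset.exists_ne_zero_of_sum_ne_zero h
    refine ⟨a, ?_, right_ne_zero_of_mul ha⟩
    rintro rfl
    exact left_ne_zero_of_mul ha (hdiag _)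
  -- At a word `i` where both vectors are nonzero, changing `i` at `r` and changing it at `t` would
  -- both lead into the support of `v`, yet the two results differ at `r`.
  have horth : ∀ r ∈ s, ∀ t ∈ s, t ≠ r → ⟪siteOp r A v, siteOp t A v⟫_ℂ = 0 := by
    intro r hr t _ htr
    rw [PiLp.inner_apply]
    refine Finset.sum_eq_zero fun i _ => ?_
    by_contra h
    rw [RCLike.inner_apply] at h
    obtain ⟨a, ha, hva⟩ := hne r i fun h0 => h (by rw [h0, map_zero, mul_zero])
    obtain ⟨b, -, hvb⟩ := hne t i fun h0 => h (by rw [h0, zero_mul])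
    have := hv _ _ hva hvb r hr
    rw [Function.update_self, Function.update_of_ne htr.symm] at this
    exact ha this
  have h1 : ‖sumOp s A v‖ ^ 2 = ∑ r ∈ s, ‖siteOp r A v‖ ^ 2 := by
    have : ⟪sumOp s A v, sumOp s A v⟫_ℂ = ∑ r ∈ s, ⟪siteOp r A v, siteOp r A v⟫_ℂ := by
      rw [sumOp, LinearMap.sum_apply, sum_inner]
      refine Finset.sum_congr rfl fun r hr => ?_
      rw [inner_sum]
      exact Finset.sum_eq_single_of_mem r hr fun t ht htr => horth r hr t ht htr
    simp only [inner_self_eq_norm_sq_to_K] at this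
    exact_mod_cast this
  rw [h1]
  refine (Finset.sum_le_card_nsmul s _ (‖v‖ ^ 2) fun r _ =>
    pow_le_pow_left₀ (norm_nonneg _) (hA r v) 2).trans ?_
  rw [nsmul_eq_mul]
  refine mul_le_mul_of_nonneg_right ?_ (sq_nonneg _)
  exact_mod_cast (Finset.card_le_univ s).trans_eq (Fintype.card_fin n)

/-! ### The state Ξ: support, norm, weight and approximate Casimir eigenvalue. -/

variable {m k l : ℕ}

/-- The positions from `k` on. -/
def tailSites (n k : ℕ) : Finset (Fin n) := Finset.univ.filter fun r : Fin n => k ≤ (r : ℕ)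

theorem mem_tailSites {r : Fin n} : r ∈ tailSites n k ↔ k ≤ (r : ℕ) := by simp [tailSites]

theorem card_tailSites (hk : k ≤ n) : (tailSites n k).card = n - k := by
  have h := Fin.card_filter_val_lt (n := n) (m := k)
  have h' := Finset.card_filter_add_card_filter_not (s := (Finset.univ : Finset (Fin n)))
    fun r => (r : ℕ) < k
  simp only [not_lt, Finset.card_univ, Fintype.card_fin] at h'
  rw [tailSites]
  omega

theorem xiVector_apply (i : Fin n → Fin 2) : xiVector n m k l i =
    if (∀ r : Fin n, (r : ℕ) < k → i r = (if (r : ℕ) < l then 1 else 0)) ∧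
      onesOn (tailSites n k) i = m - l then
        (((Real.sqrt ((n - k).choose (m - l) : ℝ))⁻¹ : ℝ) : ℂ) else 0 := by
  rw [ite_and, onesOn, tailSites, Finset.filter_filter]
  simp only [xiVector]
  split_ifs <;> simp

theorem xiVector_ne_zero {i : Fin n → Fin 2} (h : xiVector n m k l i ≠ 0) :
    (∀ r : Fin n, (r : ℕ) < k → i r = (if (r : ℕ) < l then 1 else 0)) ∧
      onesOn (tailSites n k) i = m - l := by
  rw [xiVector_apply] at h
  exact (ite_ne_right_iff.1 h).1

theorem xiVector_congr {i j : Fin n → Fin 2} (h : ∀ r ∉ tailSites n k, i r = j r)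
    (h' : onesOn (tailSites n k) i = onesOn (tailSites n k) j) :
    xiVector n m k l i = xiVector n m k l j := by
  rw [xiVector_apply, xiVector_apply, h']
  have : (∀ r : Fin n, (r : ℕ) < k → i r = (if (r : ℕ) < l then 1 else 0)) ↔
      ∀ r : Fin n, (r : ℕ) < k → j r = (if (r : ℕ) < l then 1 else 0) := by
    refine forall₂_congr fun r hr => ?_
    rw [h r (by simpa [mem_tailSites] using hr)]
  simp only [this]

theorem card_xiVector_support (hk : k ≤ n) (M : ℕ) : (Finset.univ.filter fun i : Fin n → Fin 2 =>
    (∀ r : Fin n, (r : ℕ) < k → i r = (if (r : ℕ) < l then 1 else 0)) ∧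
      onesOn (tailSites n k) i = M).card = (n - k).choose M := by
  rw [← card_tailSites hk, ← Finset.card_powersetCard]
  refine Finset.card_nbij' (fun i => (tailSites n k).filter fun r => i r = 1)
    (fun t r => if (r : ℕ) < k then (if (r : ℕ) < l then 1 else 0) else if r ∈ t then 1 else 0)
    ?_ ?_ ?_ ?_
  · intro i hi
    simp only [Finset.coe_filter, Finset.mem_univ, true_and, Set.mem_ofPred_eq] at hi
    exact Finset.mem_powersetCard.2 ⟨Finset.filter_subset _ _, hi.2⟩
  · intro t ht
    rw [Finset.mem_coe, Finset.mem_powersetCard] at ht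
    simp only [Finset.coe_filter, Finset.mem_univ, true_and, Set.mem_ofPred_eq]
    refine ⟨fun r hr => by simp [hr], ?_⟩
    rw [onesOn, ← ht.2]
    congr 1
    ext r
    rw [Finset.mem_filter, mem_tailSites]
    constructor
    · rintro ⟨h, h'⟩
      rw [if_neg (not_lt.2 h)] at h'
      by_contra hrt
      simp [hrt] at h'
    · intro h
      have := mem_tailSites.1 (ht.1 h)
      exact ⟨this, by simp [not_lt.2 this, h]⟩
  · intro i hi
    simp only [Finset.coe_filter, Finset.mem_univ, true_and, Set.mem_ofPred_eq] at hi
    ext1 r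
    by_cases hr : (r : ℕ) < k
    · simp only [hr, if_true, hi.1 r hr]
    · simp only [hr, if_false, Finset.mem_filter, mem_tailSites, not_lt.1 hr, true_and]
      generalize i r = a
      fin_cases a <;> simp
  · intro t ht
    rw [Finset.mem_coe, Finset.mem_powersetCard] at ht
    ext r
    rw [Finset.mem_filter, mem_tailSites]
    constructor
    · rintro ⟨h, h'⟩
      by_contra hrt
      simp [hrt, not_lt.2 h] at h'
    · intro h
      have := mem_tailSites.1 (ht.1 h)
      exact ⟨this, by simp [not_lt.2 this, h]⟩

theorem norm_xiVector (h : Admissible n m k l) : ‖xiVector n m k l‖ = 1 := by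
  obtain ⟨_, hk, hmk, hlm, hlk⟩ := h
  have hpos : (0 : ℝ) < (n - k).choose (m - l) := by
    exact_mod_cast Nat.choose_pos (by omega)
  have h2 : ‖xiVector n m k l‖ ^ 2 = 1 := by
    rw [EuclideanSpace.norm_sq_eq]
    simp only [xiVector_apply]
    simp only [apply_ite norm, ite_pow, norm_zero, ne_eq, OfNat.ofNat_ne_zero, not_false_eq_true,
      zero_pow, Complex.norm_real, norm_inv, Real.norm_eq_abs, abs_of_nonneg (Real.sqrt_nonneg _),
      inv_pow, Real.sq_sqrt hpos.le]
    rw [← Finset.sum_filter, Finset.sum_const, card_xiVector_support hk, nsmul_eq_mul,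
      mul_inv_cancel₀ hpos.ne']
  nlinarith [norm_nonneg (xiVector n m k l)]

theorem ones_eq_of_xiVector_ne_zero (h : Admissible n m k l) {i : Fin n → Fin 2}
    (hi : xiVector n m k l i ≠ 0) : ones i = m := by
  obtain ⟨_, hk, hmk, hlm, hlk⟩ := h
  obtain ⟨h1, h2⟩ := xiVector_ne_zero hi
  have hsplit := Finset.card_filter_add_card_filter_not
    (s := Finset.univ.filter fun r => i r = 1) fun r : Fin n => k ≤ (r : ℕ)
  rw [Finset.filter_filter, Finset.filter_filter] at hsplit
  have ha : (Finset.univ.filter fun r : Fin n => i r = 1 ∧ k ≤ (r : ℕ)).card = m - l := by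
    rw [← h2, onesOn, tailSites, Finset.filter_filter]
    simp only [and_comm]
  have hb : (Finset.univ.filter fun r : Fin n => i r = 1 ∧ ¬ k ≤ (r : ℕ)).card = l := by
    have : (Finset.univ.filter fun r : Fin n => i r = 1 ∧ ¬ k ≤ (r : ℕ)) =
        Finset.univ.filter fun r : Fin n => (r : ℕ) < l := by
      refine Finset.filter_congr fun r _ => ?_
      constructor
      · rintro ⟨hr, hr'⟩
        rw [h1 r (not_le.1 hr')] at hr
        by_contra hl
        simp [hl] at hr
      · intro hr
        have hrk : (r : ℕ) < k := by omega
        exact ⟨by rw [h1 r hrk, if_pos hr], by omega⟩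
    rw [this, Fin.card_filter_val_lt]
    omega
  rw [ones]
  omega

theorem opH_xiVector (h : Admissible n m k l) :
    opH n (xiVector n m k l) = ((n : ℂ) - 2 * m) • xiVector n m k l := by
  ext i
  rw [opH_apply, PiLp.smul_apply, smul_eq_mul]
  by_cases hi : xiVector n m k l i = 0
  · rw [hi, mul_zero, mul_zero]
  · rw [ones_eq_of_xiVector_ne_zero h hi]

/-- The approximate value of the Casimir operator in the state `xiVector n m k l`. -/
def casimirMean (n m k l : ℕ) : ℝ :=
  ((n : ℝ) - 2 * m) * ((n : ℝ) - 2 * m + 2) +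
    4 * (((m : ℝ) - l) * ((n : ℝ) - m - k + l + 1))

theorem norm_casimir_xiVector_sub_le (h : Admissible n m k l) :
    ‖casimir n (xiVector n m k l) - (casimirMean n m k l : ℂ) • xiVector n m k l‖ ^ 2 ≤
      144 * (n : ℝ) ^ 3 := by
  have hnorm := norm_xiVector h
  have hH := opH_xiVector h
  obtain ⟨hm, hk, hmk, hlm, hlk⟩ := id h
  set v := xiVector n m k l with hv
  set s := tailSites n k with hs
  have hsplit : ∀ A : Matrix (Fin 2) (Fin 2) ℂ,
      sumOp (Finset.univ : Finset (Fin n)) A = sumOp sᶜ A + sumOp s A := by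
    intro A
    exact (Finset.sum_compl_add_sum s _).symm
  have hev := sumOp_fMat_sumOp_eMat (s := s) (v := v) (M := m - l)
    (fun i j h1 h2 => xiVector_congr h1 h2) (fun i hi => (xiVector_ne_zero hi).2)
    (by rw [hs, card_tailSites hk]; omega)
  rw [hs, card_tailSites hk, ← hs, Nat.cast_sub hlm, Nat.cast_sub hk] at hev
  -- The head operator is moved next to `v`, where the `√n` bound is available.
  have hcomm : sumOp sᶜ fMat (sumOp s eMat v) = sumOp s eMat (sumOp sᶜ fMat v) :=
    LinearMap.congr_fun (sumOp_commute disjoint_compl_left fMat eMat).eq v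
  have hdiff : casimir n v - (casimirMean n m k l : ℂ) • v =
      (4 : ℂ) • (sumOp sᶜ fMat (sumOp sᶜ eMat v) + sumOp s eMat (sumOp sᶜ fMat v)
        + sumOp s fMat (sumOp sᶜ eMat v)) := by
    rw [casimir_apply, hH, map_smul, hH, opE, opF, hsplit, hsplit]
    simp only [LinearMap.add_apply, map_add]
    rw [hev, hcomm, casimirMean]
    push_cast
    module
  have hfix : ∀ i j : Fin n → Fin 2, v i ≠ 0 → v j ≠ 0 → ∀ r ∈ sᶜ, i r = j r := by
    intro i j hi hj r hr
    have hr' : (r : ℕ) < k := by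
      rw [Finset.mem_compl, hs, mem_tailSites] at hr
      omega
    rw [(xiVector_ne_zero hi).1 r hr', (xiVector_ne_zero hj).1 r hr']
  have hsq : ∀ {x : ℝ}, 0 ≤ x → x ^ 2 ≤ n * ‖v‖ ^ 2 → x ≤ Real.sqrt n := by
    intro x hx hx'
    rw [hnorm] at hx'
    exact Real.le_sqrt_of_sq_le (by linarith)
  have hE1 : ‖sumOp sᶜ eMat v‖ ≤ Real.sqrt n := hsq (norm_nonneg _)
    (norm_sumOp_sq_le norm_siteOp_eMat_le (fun a => by fin_cases a <;> simp [eMat]) hfix)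
  have hF1 : ‖sumOp sᶜ fMat v‖ ≤ Real.sqrt n := hsq (norm_nonneg _)
    (norm_sumOp_sq_le norm_siteOp_fMat_le (fun a => by fin_cases a <;> simp [fMat]) hfix)
  have hn0 : (0 : ℝ) ≤ n := Nat.cast_nonneg n
  have b1 := (norm_sumOp_le norm_siteOp_fMat_le sᶜ (sumOp sᶜ eMat v)).trans
    (mul_le_mul_of_nonneg_left hE1 hn0)
  have b2 := (norm_sumOp_le norm_siteOp_eMat_le s (sumOp sᶜ fMat v)).trans
    (mul_le_mul_of_nonneg_left hF1 hn0)
  have b3 := (norm_sumOp_le norm_siteOp_fMat_le s (sumOp sᶜ eMat v)).trans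
    (mul_le_mul_of_nonneg_left hE1 hn0)
  have hle : ‖casimir n v - (casimirMean n m k l : ℂ) • v‖ ≤ 12 * (n * Real.sqrt n) := by
    rw [hdiff, norm_smul]
    have := norm_add₃_le (a := sumOp sᶜ fMat (sumOp sᶜ eMat v))
      (b := sumOp s eMat (sumOp sᶜ fMat v)) (c := sumOp s fMat (sumOp sᶜ eMat v))
    have h4 : ‖(4 : ℂ)‖ = 4 := by simp
    rw [h4]
    linarith
  refine (pow_le_pow_left₀ (norm_nonneg _) hle 2).trans_eq ?_
  rw [mul_pow, mul_pow, Real.sq_sqrt hn0]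
  ring

/-! ### Moment bounds for the distribution. -/

theorem pmf_nonneg (x : ℕ) : 0 ≤ pmf n m k l x := by
  rw [pmf, re_inner_starProjection]
  exact sq_nonneg _

theorem sum_pmf (h : Admissible n m k l) :
    ∑ x ∈ Finset.range (n / 2 + 1), pmf n m k l x = 1 := by
  simp only [pmf]
  rw [sum_inner_starProjection, norm_xiVector h, one_pow]

theorem sum_sq_mul_pmf_le (h : Admissible n m k l) :
    ∑ x ∈ Finset.range (n / 2 + 1), (casimirValue n x - casimirMean n m k l) ^ 2 *
      pmf n m k l x ≤ 144 * (n : ℝ) ^ 3 := by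
  simp only [pmf]
  rw [sum_sq_mul_inner_starProjection]
  exact norm_casimir_xiVector_sub_le h

/-- With `t = 1 - 2ξ` and `s = √D` both nonnegative, `|s - t| ≤ s + t`, so `(s - t)⁴ ≤ (s² - t²)²`.
The fourth power thus avoids dividing by `s`, and `D = 0` needs no special treatment. -/
theorem pow_four_sub_limitMean_le {α β γ δ N x : ℝ} (hN : 0 < N) (hsum : α + β + γ + δ = 1)
    (hα : 0 ≤ α) (hβ : 0 ≤ β) (hγ : 0 ≤ γ) (hδ : 0 ≤ δ) (hx : 0 ≤ x) (hxN : 2 * x ≤ N) :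
    (x / N - limitMean α β γ δ) ^ 4 ≤
      (((N - 2 * x) * (N - 2 * x + 2) - ((N - 2 * ((α + β) * N)) * (N - 2 * ((α + β) * N) + 2) +
        4 * (β * N * (δ * N + 1)))) ^ 2 / (8 * N ^ 4)) + 2 / N ^ 2 := by
  obtain ⟨ξ, rfl⟩ : ∃ ξ, x = ξ * N := ⟨x / N, by field_simp⟩
  have hξ : 0 ≤ ξ := nonneg_of_mul_nonneg_left hx hN
  have hξ' : 2 * ξ ≤ 1 := by
    by_contra h
    nlinarith
  have hD : discr α β γ δ = (1 - 2 * α - 2 * β) ^ 2 + 4 * β * δ := by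
    rw [discr]
    have : δ = 1 - α - β - γ := by linarith
    subst this
    ring
  have hD0 : 0 ≤ discr α β γ δ := by rw [hD]; positivity
  have hsq := Real.sq_sqrt hD0
  have hs0 := Real.sqrt_nonneg (discr α β γ δ)
  rw [limitMean, mul_div_assoc, div_self hN.ne', mul_one]
  set s := Real.sqrt (discr α β γ δ) with hs
  set Δ := (N - 2 * (ξ * N)) * (N - 2 * (ξ * N) + 2) - ((N - 2 * ((α + β) * N)) *
    (N - 2 * ((α + β) * N) + 2) + 4 * (β * N * (δ * N + 1))) with hΔ
  -- The last term collects the contributions of lower order in `N`.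
  have hΔ' : (1 - 2 * ξ) ^ 2 - s ^ 2 = Δ / N ^ 2 - 4 * (α - ξ) / N := by
    rw [hsq, hD, hΔ]
    field_simp
    ring
  have h1 : 16 * (ξ - (1 - s) / 2) ^ 4 ≤ ((1 - 2 * ξ) ^ 2 - s ^ 2) ^ 2 := by
    have ha : (s - (1 - 2 * ξ)) ^ 2 ≤ (s + (1 - 2 * ξ)) ^ 2 := by nlinarith
    have := mul_le_mul_of_nonneg_left ha (sq_nonneg (s - (1 - 2 * ξ)))
    calc 16 * (ξ - (1 - s) / 2) ^ 4 = (s - (1 - 2 * ξ)) ^ 2 * (s - (1 - 2 * ξ)) ^ 2 := by ring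
      _ ≤ _ := this
      _ = _ := by ring
  have h2 : (Δ / N ^ 2 - 4 * (α - ξ) / N) ^ 2 ≤
      2 * (Δ / N ^ 2) ^ 2 + 2 * (4 * (α - ξ) / N) ^ 2 := by
    nlinarith [sq_nonneg (Δ / N ^ 2 + 4 * (α - ξ) / N)]
  have h3 : (4 * (α - ξ) / N) ^ 2 ≤ 16 / N ^ 2 := by
    rw [div_pow]
    have : (α - ξ) ^ 2 ≤ 1 := by
      rw [sq_le_one_iff_abs_le_one, abs_le]
      constructor <;> linarith
    gcongr
    nlinarith
  rw [hΔ'] at h1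
  have h4 : Δ ^ 2 / (8 * N ^ 4) = (Δ / N ^ 2) ^ 2 / 8 := by
    field_simp
  have h5 : 2 / N ^ 2 = (16 / N ^ 2) / 8 := by ring
  rw [h4, h5]
  linarith

theorem sum_pow_four_mul_pmf_le {α β γ δ : ℝ} (h : Admissible n m k l) (hn : 0 < n)
    (hα : (l : ℝ) = α * n) (hβ : (m : ℝ) - l = β * n) (hγ : (k : ℝ) - l = γ * n)
    (hδ : (n : ℝ) - m - k + l = δ * n) :
    ∑ x ∈ Finset.range (n / 2 + 1), ((x : ℝ) / n - limitMean α β γ δ) ^ 4 * pmf n m k l x ≤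
      20 / n := by
  obtain ⟨hm, hk, hmk, hlm, hlk⟩ := id h
  have hN : (0 : ℝ) < n := by exact_mod_cast hn
  have hm' : (m : ℝ) = (α + β) * n := by linarith
  have hsum : α + β + γ + δ = 1 := by
    have : (α + β + γ + δ) * n = 1 * n := by linarith
    exact mul_right_cancel₀ hN.ne' this
  have hα0 : 0 ≤ α := nonneg_of_mul_nonneg_left (hα ▸ Nat.cast_nonneg l) hN
  have hβ0 : 0 ≤ β := nonneg_of_mul_nonneg_left
    (hβ ▸ sub_nonneg.2 (Nat.cast_le.2 hlm)) hN
  have hγ0 : 0 ≤ γ := nonneg_of_mul_nonneg_left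
    (hγ ▸ sub_nonneg.2 (Nat.cast_le.2 hlk)) hN
  have hδ0 : 0 ≤ δ := by
    refine nonneg_of_mul_nonneg_left ?_ hN
    rw [← hδ]
    have : (m : ℝ) + k ≤ n + l := by exact_mod_cast hmk
    linarith
  have hterm : ∀ x ∈ Finset.range (n / 2 + 1),
      ((x : ℝ) / n - limitMean α β γ δ) ^ 4 * pmf n m k l x ≤
        (casimirValue n x - casimirMean n m k l) ^ 2 * pmf n m k l x / (8 * (n : ℝ) ^ 4) +
          2 / (n : ℝ) ^ 2 * pmf n m k l x := by
    intro x hx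
    have hx' : 2 * (x : ℝ) ≤ n := by
      rw [Finset.mem_range] at hx
      exact_mod_cast (by omega : 2 * x ≤ n)
    have hb := pow_four_sub_limitMean_le hN hsum hα0 hβ0 hγ0 hδ0 (Nat.cast_nonneg x) hx'
    have hc : casimirMean n m k l = ((n : ℝ) - 2 * ((α + β) * n)) *
        ((n : ℝ) - 2 * ((α + β) * n) + 2) + 4 * (β * n * (δ * n + 1)) := by
      rw [casimirMean, ← hβ, ← hδ, ← hm']
    rw [← hc] at hb
    refine (mul_le_mul_of_nonneg_right hb (pmf_nonneg x)).trans_eq ?_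
    rw [casimirValue]
    ring
  refine (Finset.sum_le_sum hterm).trans ?_
  rw [Finset.sum_add_distrib, ← Finset.sum_div, ← Finset.mul_sum, sum_pmf h, mul_one]
  have h1 : (1 : ℝ) ≤ n := by exact_mod_cast hn
  have h2 := div_le_div_of_nonneg_right (sum_sq_mul_pmf_le h) (by positivity :
    (0 : ℝ) ≤ 8 * (n : ℝ) ^ 4)
  -- The Casimir variance contributes 18 and the lower order terms contribute 2.
  have h3 : 144 * (n : ℝ) ^ 3 / (8 * (n : ℝ) ^ 4) = 18 / n := by
    field_simp
    norm_num
  have h4 : 2 / (n : ℝ) ^ 2 ≤ 2 / n := by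
    gcongr
    nlinarith
  have h5 : (20 : ℝ) / n = 18 / n + 2 / n := by ring
  rw [h5]
  linarith

/-! ### From moments to the law of large numbers and the expectation. -/

theorem isProbabilityMeasure_law (h : Admissible n m k l) :
    IsProbabilityMeasure (law n m k l) := by
  constructor
  simp only [law, Measure.coe_finsetSum, Finset.sum_apply, Measure.smul_apply, measure_univ,
    smul_eq_mul, mul_one]
  rw [← ENNReal.ofReal_sum_of_nonneg fun x _ => pmf_nonneg x, sum_pmf h, ENNReal.ofReal_one]

theorem integral_law (f : ℕ → ℝ) : ∫ x, f x ∂(law n m k l) =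
    ∑ x ∈ Finset.range (n / 2 + 1), f x * pmf n m k l x := by
  rw [law, integral_finsetSum_measure]
  · refine Finset.sum_congr rfl fun x _ => ?_
    rw [integral_smul_measure, integral_dirac, ENNReal.toReal_ofReal (pmf_nonneg x), smul_eq_mul,
      mul_comm]
  · exact fun x _ => (integrable_dirac (by simp)).smul_measure ENNReal.ofReal_ne_top

theorem law_real (s : Set ℕ) : (law n m k l).real s =
    ∑ x ∈ Finset.range (n / 2 + 1), s.indicator 1 x * pmf n m k l x := by
  rw [← integral_law, integral_indicator_one (Set.to_countable s).measurableSet]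

/-- Markov's inequality for the fourth power. -/
theorem law_real_deviation_le {α β γ δ ε : ℝ} (hε : 0 < ε) (h : Admissible n m k l) (hn : 0 < n)
    (hα : (l : ℝ) = α * n) (hβ : (m : ℝ) - l = β * n) (hγ : (k : ℝ) - l = γ * n)
    (hδ : (n : ℝ) - m - k + l = δ * n) :
    (law n m k l).real {x : ℕ | ε < |(x : ℝ) / n - limitMean α β γ δ|} ≤ 20 / n / ε ^ 4 := by
  rw [law_real, le_div_iff₀ (pow_pos hε 4), Finset.sum_mul]
  refine le_trans (Finset.sum_le_sum fun x _ => ?_)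
    (sum_pow_four_mul_pmf_le h hn hα hβ hγ hδ)
  rw [mul_right_comm]
  refine mul_le_mul_of_nonneg_right ?_ (pmf_nonneg x)
  by_cases hx : ε < |(x : ℝ) / n - limitMean α β γ δ|
  · rw [Set.indicator_of_mem (by exact hx), Pi.one_apply, one_mul]
    exact (pow_le_pow_left₀ hε.le hx.le 4).trans_eq (Even.pow_abs (by decide) _)
  · rw [Set.indicator_of_notMem (by exact hx), zero_mul]
    positivity

theorem abs_integral_law_sub_le {α β γ δ ε : ℝ} (hε : 0 < ε) (h : Admissible n m k l)
    (hn : 0 < n) (hα : (l : ℝ) = α * n) (hβ : (m : ℝ) - l = β * n) (hγ : (k : ℝ) - l = γ * n)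
    (hδ : (n : ℝ) - m - k + l = δ * n) :
    |(∫ x : ℕ, (x : ℝ) ∂(law n m k l)) - n * limitMean α β γ δ| ≤
      (ε + 20 / n / ε ^ 3) * n := by
  have hN : (0 : ℝ) < n := by exact_mod_cast hn
  have h1 : (∫ x : ℕ, (x : ℝ) ∂(law n m k l)) - n * limitMean α β γ δ =
      (∑ x ∈ Finset.range (n / 2 + 1),
        ((x : ℝ) / n - limitMean α β γ δ) * pmf n m k l x) * n := by
    rw [integral_law]
    simp only [sub_mul, Finset.sum_sub_distrib, ← Finset.mul_sum, sum_pmf h, mul_one]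
    rw [mul_comm (limitMean α β γ δ), Finset.sum_mul]
    congr 1
    refine Finset.sum_congr rfl fun x _ => ?_
    field_simp
  rw [h1, abs_mul, abs_of_pos hN]
  refine mul_le_mul_of_nonneg_right ((Finset.abs_sum_le_sum_abs _ _).trans ?_) hN.le
  -- Either `|z| ≤ ε`, or `(|z|/ε)³ ≥ 1` and the second term dominates.
  have hpt : ∀ z : ℝ, |z| ≤ ε + z ^ 4 / ε ^ 3 := by
    intro z
    rw [← Even.pow_abs (by decide : Even 4)]
    rcases le_or_gt |z| ε with hz | hz
    · have : 0 ≤ |z| ^ 4 / ε ^ 3 := by positivity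
      linarith
    · have : |z| ≤ |z| ^ 4 / ε ^ 3 := by
        rw [le_div_iff₀ (by positivity), pow_succ' |z| 3]
        gcongr
      linarith
  calc ∑ x ∈ Finset.range (n / 2 + 1), |((x : ℝ) / n - limitMean α β γ δ) * pmf n m k l x|
      ≤ ∑ x ∈ Finset.range (n / 2 + 1), (ε * pmf n m k l x +
          ((x : ℝ) / n - limitMean α β γ δ) ^ 4 * pmf n m k l x / ε ^ 3) := by
        refine Finset.sum_le_sum fun x _ => ?_
        rw [abs_mul, abs_of_nonneg (pmf_nonneg x)]
        refine (mul_le_mul_of_nonneg_right (hpt _) (pmf_nonneg x)).trans_eq ?_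
        ring
    _ ≤ ε + 20 / n / ε ^ 3 := by
        rw [Finset.sum_add_distrib, ← Finset.mul_sum, sum_pmf h, mul_one, ← Finset.sum_div]
        gcongr
        exact sum_pow_four_mul_pmf_le h hn hα hβ hγ hδ

end XiDist

end

/-- Law of large numbers for `P_{n,m,k,l}` in the limit `n → ∞` with fixed ratios `α = l/n`,
`β = (m-l)/n`, `γ = (k-l)/n`, `δ = (n-m-k+l)/n`; the limit is taken along an arbitrary sequence of
parameters `(n j, m j, k j, l j)` with these ratios and `n j → ∞`. -/
theorem theorem5p3 (α β γ δ : ℝ) (n m k l : ℕ → ℕ)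
    (hn : Tendsto n atTop atTop)
    (hadm : ∀ j, XiDist.Admissible (n j) (m j) (k j) (l j))
    (hα : ∀ j, (l j : ℝ) = α * n j)
    (hβ : ∀ j, (m j : ℝ) - l j = β * n j)
    (hγ : ∀ j, (k j : ℝ) - l j = γ * n j)
    (hδ : ∀ j, (n j : ℝ) - m j - k j + l j = δ * n j) :
    (∀ j, IsProbabilityMeasure (XiDist.law (n j) (m j) (k j) (l j))) ∧
    (∀ ε : ℝ, 0 < ε →
      Tendsto (fun j => (XiDist.law (n j) (m j) (k j) (l j)).real
          {x : ℕ | ε < |(x : ℝ) / n j - XiDist.limitMean α β γ δ|})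
        atTop (𝓝 0)) ∧
    (fun j => (∫ x : ℕ, (x : ℝ) ∂(XiDist.law (n j) (m j) (k j) (l j)))
        - n j * XiDist.limitMean α β γ δ) =o[atTop] (fun j => (n j : ℝ)) := by
  have hpos : ∀ᶠ j in atTop, 0 < n j := hn.eventually_gt_atTop 0
  have hinv : Tendsto (fun j => (20 : ℝ) / n j) atTop (𝓝 0) :=
    (tendsto_natCast_atTop_atTop.comp hn).const_div_atTop 20
  refine ⟨fun j => XiDist.isProbabilityMeasure_law (hadm j), fun ε hε => ?_, ?_⟩
  · have hlim : Tendsto (fun j => (20 : ℝ) / n j / ε ^ 4) atTop (𝓝 0) := by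
      simpa using hinv.div_const (ε ^ 4)
    refine squeeze_zero' (Eventually.of_forall fun j => measureReal_nonneg) ?_ hlim
    filter_upwards [hpos] with j hj
    exact XiDist.law_real_deviation_le hε (hadm j) hj (hα j) (hβ j) (hγ j) (hδ j)
  · rw [Asymptotics.isLittleO_iff]
    intro c hc
    -- Taking `ε = c/2` leaves room for the vanishing second term below `c`.
    have hlim : Tendsto (fun j => c / 2 + (20 : ℝ) / n j / (c / 2) ^ 3) atTop (𝓝 (c / 2)) := by
      simpa using (hinv.div_const ((c / 2) ^ 3)).const_add (c / 2)
    filter_upwards [hpos, hlim.eventually_le_const (half_lt_self hc)] with j hj hle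
    rw [Real.norm_eq_abs, Real.norm_eq_abs, Nat.abs_cast]
    exact (XiDist.abs_integral_law_sub_le (half_pos hc) (hadm j) hj (hα j) (hβ j) (hγ j)
      (hδ j)).trans (mul_le_mul_of_nonneg_right hle (Nat.cast_nonneg _))
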